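/- All logarithms are to base $2$. Binary polynomials are given by their lists of coefficients, and the cost of a computation is the number of elementary steps (bit operations, list cells read or written, passes through a loop). **The algorithm.** Given an integer $N\ge 0$ and $f\in\mathbb F_2[X]$ (with $\lceil\log N\rceil$ read as $0$ for $N=0$), compute $r_i=f \bmod (X^{2^i}+X)$ for $i=1,2,\dots,\lceil\log N\rceil$ in turn, by adding up the rows of length $2^i-1$ into which the coefficients of $f$ other than the constant one are arranged, and stop at the first $i=j$ with $r_j\neq 0$. Then run through the polynomials of degree $j$; keep the irreducible ones (found by trial division), divide $r_j$ by each of them by long division, and output the first one, $g$, that does not divide $r_j$. If $r_i=0$ for every $i\le\lceil\log N\rceil$, output nothing. **The brute-force search** (of the EF algorithm, confined to degrees at most $\lceil\log N\rceil$) runs through the irreducible polynomials of degree $1,2,\dots,\lceil\log N\rceil$, found and tested by the same procedures, and divides $f$ itself by each of them until one does not divide $f$. **Proposition.** 1. (Correctness.) For all $N$ and $f$: if some irreducible polynomial of degree at most $\lceil\log N\rceil$ is coprime to $f$, then the algorithm outputs an irreducible polynomial $g$ coprime to $f$ whose degree is least among all irreducible polynomials coprime to $f$; otherwise it outputs nothing.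 2. (Complexity.) There is an absolute constant $c$ such that for all integers $N\ge 1$, $h,\Lambda\ge 0$ and all $f\in\mathbb F_2[X]$ of degree at most $N\lceil\log N\rceil h\Lambda$ the cost of the algorithm is at most $$c\,N^2+c\,hN(\log N)^2\Lambda ,$$ that is, $O(N^2)+O(hN(\log N)^2\Lambda)$. With the same $c$ this bound holds for the polynomial of a network code: let a finite acyclic directed multigraph have a source $s$ and a nonempty set $\mathcal T\not\ni s$ of $N$ sinks, let $h$ be the minimum over $T\in\mathcal T$ of the maximum number of edge-disjoint paths from $s$ to $T$, and let $\Lambda$ be the length of the longest path from $s$ to a sink. Let a $d$-dimensional network code, $d\le h$, have local encoding coefficients that are binary polynomials of degree at most $\lceil\log N\rceil$: matrices $A\in\mathbb F_2[X]^{d\times E}$ supported on the edges leaving $s$, $K\in\mathbb F_2[X]^{E\times E}$ supported on the pairs of consecutive edges, and $D_T\in\mathbb F_2[X]^{E\times d}$ supported on the edges entering $T$. Then the bound holds for $f=\prod_{T\in\mathcal T}\det M_T$, where $M_T=A(1-K)^{-1}D_T$ is the network transfer matrix. 3. (Comparison with brute force.) For every $\varepsilon>0$ there is an $N_0$ such that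 for all $N\ge N_0$ and $h,\Lambda\ge 1$ there is a nonzero $f\in\mathbb F_2[X]$ of degree at most $N\lceil\log N\rceil h\Lambda$ on which the cost of the brute-force search, multiplied by $\varepsilon$, is at least the cost of the algorithm on every $f'\in\mathbb F_2[X]$ of degree at most $N\lceil\log N\rceil h\Lambda$. 4. (Comparison of the bounds.) For every $\varepsilon>0$ there is an $N_0$ such that for all $N\ge N_0$ and $h,\Lambda\ge1$, with $n=Nh\Lambda\log N$, $$N^2+hN(\log N)^2\Lambda\le\varepsilon\, N^2h\Lambda\log n\quad\text{and}\quad N^2+hN(\log N)^2\Lambda\le\varepsilon\, n^2\log n .$$ -/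

import Mathlib

open Polynomial

/-! ### Step-counting computations

A value of type `Timed α` is a result together with the number of elementary steps spent on it.
Every function below pays one step for each call it makes to itself, i.e. for each bit operation,
each list cell that is read or written, and each pass through a loop. -/

structure Timed (α : Type) where
  val : α
  cost : ℕ

instance : Monad Timed where
  pure a := ⟨a, 0⟩
  bind x k := ⟨(k x.val).val, x.cost + (k x.val).cost⟩

/-- One elementary step. -/
def tick : Timed Unit := ⟨(), 1⟩

/-! ### Binary polynomials as bit lists (constant coefficient first) -/

/-- The polynomial over `𝔽₂` with the given coefficients. -/
noncomputable def polyOfBits : List Bool → (ZMod 2)[X]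
  | [] => 0
  | b :: l => C (if b then 1 else 0) + X * polyOfBits l

/-- The coefficients of `f` up to its degree. -/
noncomputable def bitsOfPoly (f : (ZMod 2)[X]) : List Bool :=
  (List.range (f.natDegree + 1)).map fun i => decide (f.coeff i = 1)

/-- Number of cells of a list. -/
def lengthT : List Bool → Timed ℕ
  | [] => do tick; return 0
  | _ :: l => do tick; let n ← lengthT l; return n + 1

/-- Sum of two binary polynomials. -/
def addT : List Bool → List Bool → Timed (List Bool)
  | [], l => do tick; return l
  | a :: s, [] => do tick; return a :: s
  | a :: s, b :: t => do tick; let r ← addT s t; return (xor a b) :: r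

/-- The first `m` cells, and the remaining ones. -/
def splitT : ℕ → List Bool → Timed (List Bool × List Bool)
  | 0, l => do tick; return ([], l)
  | _ + 1, [] => do tick; return ([], [])
  | m + 1, b :: l => do tick; let p ← splitT m l; return (b :: p.1, p.2)

/-- Is the polynomial zero? -/
def isZeroT : List Bool → Timed Bool
  | [] => do tick; return true
  | b :: l => do tick; if b then return false else isZeroT l

/-- The last bit (`false` for the empty list). -/
def lastT : List Bool → Timed Bool
  | [] => do tick; return false
  | [b] => do tick; return b
  | _ :: b :: l => do tick; lastT (b :: l)

/-- The list without its last bit. -/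
def dropLastT : List Bool → Timed (List Bool)
  | [] => do tick; return []
  | [_] => do tick; return []
  | a :: b :: l => do tick; let r ← dropLastT (b :: l); return a :: r

/-- As many zeros as the list has cells, less one. -/
def zerosT : List Bool → Timed (List Bool)
  | [] => do tick; return []
  | [_] => do tick; return []
  | _ :: b :: l => do tick; let r ← zerosT (b :: l); return false :: r

/-! ### Reduction modulo `X ^ (2 ^ i) + X` -/

/-- Cut a list into rows of `m` cells and add up the rows. The first argument only limits the
number of rows. -/
def sumRowsT : ℕ → ℕ → List Bool → Timed (List Bool)
  | 0, _, _ => do tick; return []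
  | _ + 1, _, [] => do tick; return []
  | k + 1, m, b :: l => do
      tick
      let p ← splitT m (b :: l)
      let r ← sumRowsT k m p.2
      addT p.1 r

/-- `f mod (X ^ (2 ^ i) + X)`: keep the constant coefficient, arrange the others in rows of
`2 ^ i - 1` and add up the rows. -/
def reduceT (i : ℕ) : List Bool → Timed (List Bool)
  | [] => do tick; return []
  | c :: l => do
      tick
      let n ← lengthT l
      let r ← sumRowsT n (2 ^ i - 1) l
      return c :: r

/-! ### Long division by a polynomial with top coefficient `1` -/

/-- For `v` with as many bits as `g`: subtract `g` if the top bit of `v` is set, and drop that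
bit. -/
def divStepT (g v : List Bool) : Timed (List Bool) := do
  let t ← lastT v
  let w ← (if t then addT v g else pure v)
  dropLastT w

/-- `f mod g` by long division, where the last bit of `g` is its leading coefficient `1`. -/
def remT (g : List Bool) : List Bool → Timed (List Bool)
  | [] => do tick; zerosT g
  | b :: f => do tick; let r ← remT g f; divStepT g (b :: r)

/-! ### Listing the irreducible polynomials of a given degree -/

def consAllT (b : Bool) : List (List Bool) → Timed (List (List Bool))
  | [] => do tick; return []
  | p :: L => do tick; let r ← consAllT b L; return (b :: p) :: r

def appendT : List (List Bool) → List (List Bool) → Timed (List (List Bool))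
  | [], M => do tick; return M
  | p :: L, M => do tick; let r ← appendT L M; return p :: r

/-- All binary polynomials of degree exactly `d`. -/
def monicsT : ℕ → Timed (List (List Bool))
  | 0 => do tick; return [[true]]
  | d + 1 => do
      tick
      let L ← monicsT d
      let A ← consAllT false L
      let B ← consAllT true L
      appendT A B

/-- No member of the list divides `q`. -/
def noDivisorInT (q : List Bool) : List (List Bool) → Timed Bool
  | [] => do tick; return true
  | p :: L => do
      tick
      let r ← remT p q
      let z ← isZeroT r
      if z then return false else noDivisorInT q L

/-- No polynomial of degree `1, …, e` divides `q`. -/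
def noDivisorUpToT (q : List Bool) : ℕ → Timed Bool
  | 0 => do tick; return true
  | e + 1 => do
      tick
      let L ← monicsT (e + 1)
      let ok ← noDivisorInT q L
      if ok then noDivisorUpToT q e else return false

/-- Irreducibility test for a polynomial `q` of degree `d ≥ 1`, by trial division. -/
def irreducibleT (d : ℕ) (q : List Bool) : Timed Bool := noDivisorUpToT q (d / 2)

/-- The first irreducible polynomial in a list of polynomials of degree `d` that does not
divide `f` (for an irreducible polynomial: that is coprime to `f`). -/
def firstCoprimeT (d : ℕ) (f : List Bool) : List (List Bool) → Timed (Option (List Bool))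
  | [] => do tick; return none
  | q :: L => do
      tick
      let irr ← irreducibleT d q
      if irr then do
        let r ← remT q f
        let z ← isZeroT r
        if z then firstCoprimeT d f L else return some q
      else firstCoprimeT d f L

/-- Test the irreducible polynomials of degree `d` one after the other for coprimality to `f`. -/
def searchDegreeT (d : ℕ) (f : List Bool) : Timed (Option (List Bool)) := do
  let L ← monicsT d
  firstCoprimeT d f L

/-! ### The two algorithms -/

/-- `n` further passes, beginning with `X ^ (2 ^ i) + X`: at the first index whose remainder is
nonzero, test the irreducible polynomials of that degree against the remainder. -/
def fastLoopT (f : List Bool) : ℕ → ℕ → Timed (Option (List Bool))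
  | 0, _ => do tick; return none
  | n + 1, i => do
      tick
      let r ← reduceT i f
      let z ← isZeroT r
      if z then fastLoopT f n (i + 1) else searchDegreeT i r

/-- The fast algorithm: `i = 1, …, ⌈log₂ N⌉`. -/
def fastCoprime (N : ℕ) (f : List Bool) : Timed (Option (List Bool)) :=
  fastLoopT f (Nat.clog 2 N) 1

/-- `n` further passes, beginning with degree `i`: test all irreducible polynomials of the current
degree directly against `f`. -/
def bruteLoopT (f : List Bool) : ℕ → ℕ → Timed (Option (List Bool))
  | 0, _ => do tick; return none
  | n + 1, i => do
      tick
      let o ← searchDegreeT i f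
      match o with
      | some g => return some g
      | none => bruteLoopT f n (i + 1)

/-- The brute-force search, confined to degrees `1, …, ⌈log₂ N⌉`. -/
def bruteCoprime (N : ℕ) (f : List Bool) : Timed (Option (List Bool)) :=
  bruteLoopT f (Nat.clog 2 N) 1

/-- What the algorithms are to output on input `f`. -/
def IsLeastCoprime (N : ℕ) (f : (ZMod 2)[X]) : Option (List Bool) → Prop
  | some l =>
      (polyOfBits l).natDegree ≤ Nat.clog 2 N ∧
      Irreducible (polyOfBits l) ∧ IsCoprime (polyOfBits l) f ∧
      ∀ q : (ZMod 2)[X], Irreducible q → IsCoprime q f → (polyOfBits l).natDegree ≤ q.natDegree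
  | none =>
      ∀ q : (ZMod 2)[X], Irreducible q → q.natDegree ≤ Nat.clog 2 N → ¬ IsCoprime q f

/-! ### Networks and network codes -/

/-- A directed multigraph with vertices `V` and (unit capacity) edges `E`. -/
structure DirMultigraph (V E : Type*) where
  src : E → V
  tgt : E → V

/-- The edges `p` form a directed walk from `u` to `v`. -/
def DirMultigraph.IsWalk {V E : Type*} (G : DirMultigraph V E) : V → List E → V → Prop
  | u, [], v => u = v
  | u, e :: p, v => G.src e = u ∧ G.IsWalk (G.tgt e) p v

/-- A single-source acyclic multicast network. -/
structure MulticastNetwork (V E : Type*) extends DirMultigraph V E where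
  acyclic : ∀ (v : V) (p : List E), toDirMultigraph.IsWalk v p v → p = []
  source : V
  sinks : Finset V
  sinks_nonempty : sinks.Nonempty
  source_notMem : source ∉ sinks

namespace MulticastNetwork

variable {V E : Type*}

/-- The maximum number of edge-disjoint paths from the source to `T`. -/
noncomputable def unicastCapacity (G : MulticastNetwork V E) (T : V) : ℕ :=
  sSup {n | ∃ p : Fin n → List E, (∀ i, G.IsWalk G.source (p i) T) ∧
    Pairwise fun i j => (p i).Disjoint (p j)}

/-- The min-cut of the multicast connection. -/
noncomputable def minCut (G : MulticastNetwork V E) : ℕ :=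
  G.sinks.inf' G.sinks_nonempty G.unicastCapacity

/-- The length of the longest path from the source to a sink. -/
noncomputable def longestPath (G : MulticastNetwork V E) : ℕ :=
  sSup {n | ∃ T ∈ G.sinks, ∃ p : List E, G.IsWalk G.source p T ∧ p.length = n}

/-- Local encoding coefficients, with values in `R`, of a `d`-dimensional code: `A` injects the
symbols into the edges leaving the source, `K` combines the edges entering a node on each edge
leaving it, and `D T` combines the edges entering the sink `T`. -/
structure Code (G : MulticastNetwork V E) (R : Type*) [CommRing R] (d : ℕ) where
  A : Matrix (Fin d) E R
  K : Matrix E E R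
  D : V → Matrix E (Fin d) R
  A_supp : ∀ i e, G.src e ≠ G.source → A i e = 0
  K_supp : ∀ e e', G.tgt e ≠ G.src e' → K e e' = 0
  D_supp : ∀ T e j, G.tgt e ≠ T → D T e j = 0

variable {G : MulticastNetwork V E} {R : Type*} [CommRing R] {d : ℕ} [Fintype E] [DecidableEq E]

/-- The network transfer matrix `M_T = A F D_T`, with `F = (1 - K)⁻¹ = 1 + K + K ^ 2 + ⋯`. -/
noncomputable def Code.transfer (c : G.Code R d) (T : V) : Matrix (Fin d) (Fin d) R :=
  c.A * (1 - c.K)⁻¹ * c.D T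

/-- The product of the determinants of the transfer matrices. -/
noncomputable def Code.detProd (c : G.Code R d) : R := ∏ T ∈ G.sinks, (c.transfer T).det

end MulticastNetwork

/-- The binary polynomials chosen as coefficients all have degree at most `b`. -/
def MulticastNetwork.Code.DegreeLE {V E : Type*} {G : MulticastNetwork V E} {d : ℕ}
    (c : G.Code (ZMod 2)[X] d) (b : ℕ) : Prop :=
  (∀ i e, (c.A i e).natDegree ≤ b) ∧ (∀ e e', (c.K e e').natDegree ≤ b) ∧
    ∀ T e j, (c.D T e j).natDegree ≤ b

/-! ### Results and costs of compound computations -/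

/-! Over `𝔽₂`, `X ^ 2 ^ i - X` is squarefree and its irreducible factors are the irreducible
polynomials of degree dividing `i`. Hence, if every irreducible polynomial of degree less than `i`
divides `f`, then `r_i = 0` exactly when those of degree `i` divide `f` too. So the first `j` with
`r_j ≠ 0` is the least degree of an irreducible polynomial coprime to `f`; and since `r_j ≡ f`
modulo every irreducible of degree `j`, the search may use the short `r_j` in place of `f`
(`fastLoopT_val`).

Cost: put `L = ⌈log N⌉`, so `2 ^ L ≤ 2 * N`. Each of the at most `L` reductions is linear in the
length of `f`. The search runs once, on at most `2 ^ j` bits. Its `2 ^ j` irreducibility tests cost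
`O(2 ^ j)` each. Irreducibles of degree `j` dividing `r_j` are pairwise coprime, so there are at
most `2 ^ j / j` of them, and each division costs `O(j * 2 ^ j)`. The search is thus `O(4 ^ j) = O(N
^ 2)` (`searchDegreeT_cost_le`).

Network codes: acyclicity makes `K` nilpotent, so `(1 - K)⁻¹` is a finite geometric sum whose terms
follow walks. A walk of at most `Λ` edges contributes at most `Λ + 1` coefficients, which bounds the
degree of the determinants.

Brute force: let `f` have the full degree `D = N * L * h * Λ` and be divisible by all irreducibles
of degree at most `L`. Every division is then carried out, at cost at least `deg f` times the degree
of the divisor. These degrees sum to at least `2 ^ L ≥ N`, since `X ^ 2 ^ L - X` divides the product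
of the divisors. So brute force costs at least `D * N`, against `O(L * D + N ^ 2)`. -/

@[simp] theorem Timed.val_bind {α β : Type} (x : Timed α) (k : α → Timed β) :
    (x >>= k).val = (k x.val).val := rfl

@[simp] theorem Timed.cost_bind {α β : Type} (x : Timed α) (k : α → Timed β) :
    (x >>= k).cost = x.cost + (k x.val).cost := rfl

@[simp] theorem Timed.val_pure {α : Type} (a : α) : (pure a : Timed α).val = a := rfl

@[simp] theorem Timed.cost_pure {α : Type} (a : α) : (pure a : Timed α).cost = 0 := rfl

@[simp] theorem tick_cost : tick.cost = 1 := rfl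

/-! ### Bit lists as polynomials -/

@[simp] theorem polyOfBits_nil : polyOfBits [] = 0 := rfl

theorem polyOfBits_cons (b : Bool) (l : List Bool) :
    polyOfBits (b :: l) = C (if b then 1 else 0) + X * polyOfBits l := rfl

theorem polyOfBits_append (a b : List Bool) :
    polyOfBits (a ++ b) = polyOfBits a + X ^ a.length * polyOfBits b := by
  induction a with
  | nil => simp
  | cons x a ih =>
    rw [List.cons_append, polyOfBits_cons, ih, polyOfBits_cons, List.length_cons]
    ring

theorem coeff_polyOfBits (l : List Bool) (n : ℕ) :
    (polyOfBits l).coeff n = if l.getD n false then 1 else 0 := by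
  induction l generalizing n with
  | nil => simp
  | cons b l ih =>
    rw [polyOfBits_cons]
    cases n with
    | zero => cases b <;> simp
    | succ n => cases b <;> simp [ih, coeff_one]

theorem degree_polyOfBits_lt (l : List Bool) : (polyOfBits l).degree < l.length := by
  rw [degree_lt_iff_coeff_zero]
  intro m hm
  rw [coeff_polyOfBits, List.getD_eq_default _ _ hm]
  simp

theorem natDegree_polyOfBits_lt {l : List Bool} (h : polyOfBits l ≠ 0) :
    (polyOfBits l).natDegree < l.length :=
  (natDegree_lt_iff_degree_lt h).2 (degree_polyOfBits_lt l)

theorem polyOfBits_injective {a b : List Bool} (h : a.length = b.length)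
    (hab : polyOfBits a = polyOfBits b) : a = b := by
  refine List.ext_getElem h fun n h₁ h₂ => ?_
  have := congrArg (fun p => p.coeff n) hab
  simp only [coeff_polyOfBits, List.getD_eq_getElem _ _ h₁, List.getD_eq_getElem _ _ h₂] at this
  revert this
  cases a[n] <;> cases b[n] <;> simp

theorem zmod_two_eq_ite (a : ZMod 2) : (if a = 1 then 1 else 0) = a := by
  revert a
  decide

@[simp] theorem length_bitsOfPoly (f : (ZMod 2)[X]) :
    (bitsOfPoly f).length = f.natDegree + 1 := by
  simp [bitsOfPoly]

@[simp] theorem polyOfBits_bitsOfPoly (f : (ZMod 2)[X]) : polyOfBits (bitsOfPoly f) = f := by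
  ext n
  rw [coeff_polyOfBits]
  by_cases hn : n < f.natDegree + 1
  · rw [List.getD_eq_getElem _ _ (by simpa using hn)]
    simp [bitsOfPoly, zmod_two_eq_ite]
  · rw [List.getD_eq_default _ _ (by simpa using hn), coeff_eq_zero_of_natDegree_lt (by omega)]
    simp

theorem monic_of_ne_zero {f : (ZMod 2)[X]} (h : f ≠ 0) : f.Monic := by
  have h1 : ∀ a : ZMod 2, a ≠ 0 → a = 1 := by decide
  exact h1 _ (leadingCoeff_ne_zero.2 h)

/-- The bit list represents a polynomial of degree exactly `d`. -/
def IsMonicBits (d : ℕ) (l : List Bool) : Prop := ∃ a : List Bool, a.length = d ∧ l = a ++ [true]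

namespace IsMonicBits

variable {d : ℕ} {l : List Bool}

theorem length_eq (h : IsMonicBits d l) : l.length = d + 1 := by
  obtain ⟨a, rfl, rfl⟩ := h
  simp

theorem degree_eq (h : IsMonicBits d l) : (polyOfBits l).degree = d := by
  obtain ⟨a, rfl, rfl⟩ := h
  rw [polyOfBits_append, polyOfBits_cons, polyOfBits_nil]
  simp only [if_true, map_one, mul_zero, add_zero, mul_one]
  rw [degree_add_eq_right_of_degree_lt] <;> simp [degree_polyOfBits_lt]

theorem natDegree_eq (h : IsMonicBits d l) : (polyOfBits l).natDegree = d :=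
  natDegree_eq_of_degree_eq_some h.degree_eq

theorem ne_zero (h : IsMonicBits d l) : polyOfBits l ≠ 0 := by
  intro h0
  have := h.degree_eq
  simp [h0] at this

end IsMonicBits

theorem isMonicBits_bitsOfPoly {f : (ZMod 2)[X]} (h : f ≠ 0) :
    IsMonicBits f.natDegree (bitsOfPoly f) := by
  refine ⟨(List.range f.natDegree).map fun i => decide (f.coeff i = 1), by simp, ?_⟩
  have : f.coeff f.natDegree = 1 := monic_of_ne_zero h
  simp [bitsOfPoly, List.range_succ, this]

/-! ### Elementary list operations -/

@[simp] theorem lengthT_val (l : List Bool) : (lengthT l).val = l.length := by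
  induction l with
  | nil => simp [lengthT]
  | cons b l ih => simp [lengthT, ih]

theorem lengthT_cost (l : List Bool) : (lengthT l).cost = l.length + 1 := by
  induction l with
  | nil => simp [lengthT]
  | cons b l ih => simp [lengthT, ih]; omega

theorem length_addT (a b : List Bool) : (addT a b).val.length = max a.length b.length := by
  induction a generalizing b with
  | nil => simp [addT]
  | cons x a ih => cases b <;> simp [addT, ih]

theorem polyOfBits_addT (a b : List Bool) :
    polyOfBits (addT a b).val = polyOfBits a + polyOfBits b := by
  induction a generalizing b with
  | nil => simp [addT]
  | cons x a ih =>
    cases b with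
    | nil => simp [addT]
    | cons y b =>
      have h : (C (if (xor x y) = true then 1 else 0) : (ZMod 2)[X]) =
          C (if x = true then 1 else 0) + C (if y = true then 1 else 0) := by
        rw [← C_add]
        congr 1
        revert x y
        decide
      simp only [addT, Timed.val_bind, Timed.val_pure, polyOfBits_cons, ih, h]
      ring

theorem addT_concat (a b : List Bool) (s t : Bool) (h : a.length = b.length) :
    (addT (a ++ [s]) (b ++ [t])).val = (addT a b).val ++ [xor s t] := by
  induction a generalizing b with
  | nil =>
    obtain rfl : b = [] := by simpa using h.symm
    simp [addT]
  | cons x a ih =>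
    cases b with
    | nil => simp at h
    | cons y b => simp [addT, ih b (by simpa using h)]

theorem addT_cost_le (a b : List Bool) : (addT a b).cost ≤ a.length + 1 := by
  induction a generalizing b with
  | nil => simp [addT]
  | cons x a ih =>
    cases b with
    | nil => simp [addT]
    | cons y b =>
      have := ih b
      simp [addT]
      omega

@[simp] theorem splitT_val (m : ℕ) (l : List Bool) : (splitT m l).val = (l.take m, l.drop m) := by
  induction m generalizing l with
  | zero => simp [splitT]
  | succ m ih => cases l <;> simp [splitT, ih]

theorem splitT_cost_le (m : ℕ) (l : List Bool) : (splitT m l).cost ≤ min m l.length + 1 := by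
  induction m generalizing l with
  | zero => simp [splitT]
  | succ m ih =>
    cases l with
    | nil => simp [splitT]
    | cons b l =>
      have := ih l
      simp [splitT]
      omega

@[simp] theorem isZeroT_val (l : List Bool) : (isZeroT l).val = true ↔ polyOfBits l = 0 := by
  induction l with
  | nil => simp [isZeroT]
  | cons b l ih =>
    cases b with
    | false => simp [isZeroT, ih, polyOfBits_cons]
    | true =>
      simp only [isZeroT, Timed.val_bind, if_true, Timed.val_pure, Bool.false_eq_true, false_iff]
      intro h
      have := congrArg (fun p => p.coeff 0) h
      simp [coeff_polyOfBits] at this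

theorem isZeroT_cost_le (l : List Bool) : (isZeroT l).cost ≤ l.length + 1 := by
  induction l with
  | nil => simp [isZeroT]
  | cons b l ih =>
    cases b <;> simp [isZeroT]
    omega

@[simp] theorem lastT_concat_val (l : List Bool) (b : Bool) : (lastT (l ++ [b])).val = b := by
  induction l with
  | nil => simp [lastT]
  | cons a l ih => cases l <;> simp_all [lastT]

theorem lastT_cost (l : List Bool) : (lastT l).cost = max l.length 1 := by
  induction l with
  | nil => simp [lastT]
  | cons a l ih => cases l <;> simp_all [lastT]; omega

@[simp] theorem dropLastT_val (l : List Bool) : (dropLastT l).val = l.dropLast := by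
  induction l with
  | nil => simp [dropLastT]
  | cons a l ih => cases l <;> simp_all [dropLastT]

theorem dropLastT_cost_le (l : List Bool) : (dropLastT l).cost ≤ l.length + 1 := by
  induction l with
  | nil => simp [dropLastT]
  | cons a l ih => cases l <;> simp_all [dropLastT]; omega

@[simp] theorem zerosT_val (l : List Bool) :
    (zerosT l).val = List.replicate (l.length - 1) false := by
  induction l with
  | nil => simp [zerosT]
  | cons a l ih => cases l <;> simp_all [zerosT, List.replicate_succ]

theorem zerosT_cost_le (l : List Bool) : (zerosT l).cost ≤ l.length + 1 := by
  induction l with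
  | nil => simp [zerosT]
  | cons a l ih => cases l <;> simp_all [zerosT]; omega

@[simp] theorem polyOfBits_replicate_false (n : ℕ) : polyOfBits (List.replicate n false) = 0 := by
  induction n with
  | zero => simp
  | succ n ih => simp [List.replicate_succ, polyOfBits_cons, ih]

/-! ### Reduction modulo `X ^ (2 ^ i) + X` -/

theorem length_sumRowsT_le (k m : ℕ) (l : List Bool) : (sumRowsT k m l).val.length ≤ m := by
  induction k generalizing l with
  | zero => simp [sumRowsT]
  | succ k ih =>
    cases l with
    | nil => simp [sumRowsT]
    | cons b l =>
      have := ih ((b :: l).drop m)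
      simp [sumRowsT, length_addT, this]

/-- Modulo `X ^ m - 1`, shifting a row by `m` places changes nothing. Each row uses up at least one
cell, so `l.length` rows are enough. -/
theorem X_pow_sub_one_dvd_sumRowsT {k m : ℕ} (hm : 1 ≤ m) {l : List Bool} (hk : l.length ≤ k) :
    (X ^ m - 1 : (ZMod 2)[X]) ∣ polyOfBits l - polyOfBits (sumRowsT k m l).val := by
  induction k generalizing l with
  | zero =>
    obtain rfl : l = [] := by simpa using hk
    simp [sumRowsT]
  | succ k ih =>
    cases l with
    | nil => simp [sumRowsT]
    | cons b l =>
      have h := ih (l := (b :: l).drop m) (by simp at hk ⊢; omega)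
      simp only [sumRowsT, Timed.val_bind, splitT_val, polyOfBits_addT]
      obtain hl | hl := le_or_gt m (b :: l).length
      · have e := polyOfBits_append ((b :: l).take m) ((b :: l).drop m)
        rw [List.take_append_drop, List.length_take, min_eq_left hl] at e
        rw [e]
        have : (X ^ m - 1 : (ZMod 2)[X]) ∣ (X ^ m - 1) * polyOfBits ((b :: l).drop m) :=
          dvd_mul_right _ _
        convert dvd_add this h using 1
        ring
      · rw [List.take_of_length_le hl.le, List.drop_of_length_le hl.le] at *
        simpa using h

/-- Cutting off and adding a row of `s ≥ 1` cells costs at most `2 * s + 3 ≤ 5 * s`: `addT` pays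
only for its first argument, here the new row. -/
theorem sumRowsT_cost_le {k m : ℕ} (hm : 1 ≤ m) (l : List Bool) :
    (sumRowsT k m l).cost ≤ 5 * l.length + 1 := by
  induction k generalizing l with
  | zero => simp [sumRowsT]
  | succ k ih =>
    cases l with
    | nil => simp [sumRowsT]
    | cons b l =>
      have h₁ := ih ((b :: l).drop m)
      have h₂ := splitT_cost_le m (b :: l)
      have h₃ := addT_cost_le ((b :: l).take m) (sumRowsT k m ((b :: l).drop m)).val
      simp only [List.length_take, List.length_drop, List.length_cons] at h₁ h₂ h₃
      simp only [sumRowsT, Timed.cost_bind, splitT_val, tick_cost, List.length_cons]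
      omega

theorem length_reduceT_le (i : ℕ) (l : List Bool) : (reduceT i l).val.length ≤ 2 ^ i := by
  cases l with
  | nil => simp [reduceT]
  | cons c l =>
    have := length_sumRowsT_le l.length (2 ^ i - 1) l
    have := Nat.one_le_two_pow (n := i)
    simp [reduceT]
    omega

/-- `X ^ 2 ^ i - X = X * (X ^ (2 ^ i - 1) - 1)`, so the constant bit stays and the remaining bits
fold modulo the second factor. -/
theorem X_pow_sub_X_dvd_reduceT {i : ℕ} (hi : 1 ≤ i) (l : List Bool) :
    (X ^ 2 ^ i - X : (ZMod 2)[X]) ∣ polyOfBits l - polyOfBits (reduceT i l).val := by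
  cases l with
  | nil => simp [reduceT]
  | cons c l =>
    have h2 : 2 ≤ 2 ^ i := Nat.le_self_pow (by omega) 2
    obtain ⟨p, hp⟩ := X_pow_sub_one_dvd_sumRowsT (m := 2 ^ i - 1) (by omega) (le_refl l.length)
    refine ⟨p, ?_⟩
    have e : (X ^ 2 ^ i : (ZMod 2)[X]) = X * X ^ (2 ^ i - 1) := by
      rw [← pow_succ', Nat.sub_add_cancel (by omega)]
    simp only [reduceT, Timed.val_bind, lengthT_val, Timed.val_pure, polyOfBits_cons]
    rw [e]
    linear_combination X * hp

theorem reduceT_cost_le {i : ℕ} (hi : 1 ≤ i) (l : List Bool) :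
    (reduceT i l).cost ≤ 6 * l.length + 3 := by
  cases l with
  | nil => simp [reduceT]
  | cons c l =>
    have h2 : 2 ≤ 2 ^ i := Nat.le_self_pow (by omega) 2
    have := sumRowsT_cost_le (k := l.length) (m := 2 ^ i - 1) (by omega) l
    simp [reduceT, lengthT_cost]
    omega

/-! ### Long division -/

theorem divStepT_concat_val (g v : List Bool) (t : Bool) (h : v.length = g.length) :
    (divStepT (g ++ [true]) (v ++ [t])).val = if t then (addT v g).val else v := by
  cases t <;> simp [divStepT, addT_concat _ _ _ _ h]

/-- Remainders are padded to exactly `d` bits, so that `b :: r` always lines up with the `d + 1`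
bits of `g`. -/
theorem length_remT {d : ℕ} {g : List Bool} (hg : IsMonicBits d g) (f : List Bool) :
    (remT g f).val.length = d := by
  obtain ⟨g, rfl, rfl⟩ := hg
  induction f with
  | nil => simp [remT]
  | cons b f ih =>
    set r := (remT (g ++ [true]) f).val with hr
    simp only [remT, Timed.val_bind, ← hr]
    obtain ⟨v, t, hv⟩ : ∃ v t, b :: r = v ++ [t] :=
      ⟨_, _, (List.dropLast_concat_getLast (List.cons_ne_nil b r)).symm⟩
    have hl : v.length = g.length := by
      have := congrArg List.length hv
      simp at this
      omega
    rw [hv, divStepT_concat_val _ _ _ hl]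
    split_ifs <;> simp [length_addT, hl]

/-- Horner's scheme: if `r` is the remainder of the tail, then `b + X * r` has degree at most `d`,
and at most one subtraction of `g` remains. -/
theorem dvd_sub_remT {d : ℕ} {g : List Bool} (hg : IsMonicBits d g) (f : List Bool) :
    polyOfBits g ∣ polyOfBits f - polyOfBits (remT g f).val := by
  have hlen := length_remT hg
  obtain ⟨g, rfl, rfl⟩ := hg
  induction f with
  | nil => simp [remT]
  | cons b f ih =>
    set r := (remT (g ++ [true]) f).val with hr
    simp only [remT, Timed.val_bind, ← hr]
    obtain ⟨v, t, hv⟩ : ∃ v t, b :: r = v ++ [t] :=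
      ⟨_, _, (List.dropLast_concat_getLast (List.cons_ne_nil b r)).symm⟩
    have hl : v.length = g.length := by
      have := congrArg List.length hv
      simp [hr, hlen] at this
      omega
    have hbr : polyOfBits (b :: f) - polyOfBits (b :: r) = X * (polyOfBits f - polyOfBits r) := by
      rw [polyOfBits_cons, polyOfBits_cons]
      ring
    have h₁ : polyOfBits (g ++ [true]) ∣ polyOfBits (b :: f) - polyOfBits (b :: r) := by
      rw [hbr]
      exact ih.mul_left _
    rw [hv] at h₁ ⊢
    rw [divStepT_concat_val _ _ _ hl]
    cases t with
    | false => simpa [polyOfBits_append v, polyOfBits_cons] using h₁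
    | true =>
      -- The two leading terms `X ^ d` cancel, and adding `g` is subtracting it in characteristic
      -- two.
      convert dvd_add h₁ (dvd_refl _) using 1
      simp only [if_true, polyOfBits_addT, polyOfBits_append v, polyOfBits_append g, hl]
      rw [← CharTwo.sub_eq_add (polyOfBits v)]
      ring

/-- Long division finds the remainder `0` exactly for the multiples of the divisor. -/
theorem polyOfBits_remT_eq_zero_iff {d : ℕ} {g : List Bool} (hg : IsMonicBits d g)
    (f : List Bool) : polyOfBits (remT g f).val = 0 ↔ polyOfBits g ∣ polyOfBits f := by
  have h := dvd_sub_remT hg f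
  constructor
  · intro h0
    simpa [h0] using h
  · intro hd
    refine eq_zero_of_dvd_of_degree_lt ((dvd_sub_right hd).1 h) ?_
    rw [hg.degree_eq, ← length_remT hg f]
    exact degree_polyOfBits_lt _

theorem remT_cost_le {d : ℕ} {g : List Bool} (hg : IsMonicBits d g) (f : List Bool) :
    (remT g f).cost ≤ (f.length + 1) * (3 * d + 7) := by
  have hgl := hg.length_eq
  induction f with
  | nil =>
    have := zerosT_cost_le g
    simp [remT]
    omega
  | cons b f ih =>
    have hr := length_remT hg f
    have h₁ := lastT_cost (b :: (remT g f).val)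
    have h₂ := addT_cost_le (b :: (remT g f).val) g
    have h₃ := dropLastT_cost_le (b :: (remT g f).val)
    have h₄ := dropLastT_cost_le (addT (b :: (remT g f).val) g).val
    simp only [length_addT, List.length_cons, hr, hgl, max_self] at h₁ h₂ h₃ h₄
    have : (divStepT g (b :: (remT g f).val)).cost ≤ 3 * d + 6 := by
      simp only [divStepT, Timed.cost_bind]
      split_ifs
      · omega
      · simp only [Timed.cost_pure, Timed.val_pure]
        omega
    simp only [remT, Timed.cost_bind, tick_cost, List.length_cons]
    nlinarith

/-- Reading the top bit alone walks through `d + 1` cells for each bit of `f`. This feeds the lower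
bound for brute force. -/
theorem le_remT_cost {d : ℕ} {g : List Bool} (hg : IsMonicBits d g) (f : List Bool) :
    f.length * d ≤ (remT g f).cost := by
  induction f with
  | nil => simp
  | cons b f ih =>
    have hr := length_remT hg f
    have h₁ := lastT_cost (b :: (remT g f).val)
    simp only [List.length_cons, hr] at h₁
    simp only [remT, divStepT, Timed.cost_bind, tick_cost, List.length_cons]
    rw [h₁, add_mul]
    omega

/-! ### Listing the polynomials of a given degree -/

@[simp] theorem consAllT_val (b : Bool) (L : List (List Bool)) :
    (consAllT b L).val = L.map (b :: ·) := by
  induction L with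
  | nil => simp [consAllT]
  | cons p L ih => simp [consAllT, ih]

theorem consAllT_cost (b : Bool) (L : List (List Bool)) :
    (consAllT b L).cost = L.length + 1 := by
  induction L with
  | nil => simp [consAllT]
  | cons p L ih => simp [consAllT, ih]; omega

@[simp] theorem appendT_val (L M : List (List Bool)) : (appendT L M).val = L ++ M := by
  induction L with
  | nil => simp [appendT]
  | cons p L ih => simp [appendT, ih]

theorem appendT_cost (L M : List (List Bool)) : (appendT L M).cost = L.length + 1 := by
  induction L with
  | nil => simp [appendT]
  | cons p L ih => simp [appendT, ih]; omega

theorem mem_monicsT {d : ℕ} {l : List Bool} : l ∈ (monicsT d).val ↔ IsMonicBits d l := by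
  induction d generalizing l with
  | zero => simp [monicsT, IsMonicBits]
  | succ d ih =>
    simp only [monicsT, Timed.val_bind, consAllT_val, appendT_val, List.mem_append, List.mem_map,
      ih]
    constructor
    · rintro (⟨_, ⟨a, rfl, rfl⟩, rfl⟩ | ⟨_, ⟨a, rfl, rfl⟩, rfl⟩)
      · exact ⟨false :: a, rfl, rfl⟩
      · exact ⟨true :: a, rfl, rfl⟩
    · rintro ⟨a, ha, rfl⟩
      cases a with
      | nil => simp at ha
      | cons b a =>
        have hm : IsMonicBits d (a ++ [true]) := ⟨a, by simpa using ha, rfl⟩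
        cases b
        · exact Or.inl ⟨_, hm, rfl⟩
        · exact Or.inr ⟨_, hm, rfl⟩

theorem length_monicsT (d : ℕ) : (monicsT d).val.length = 2 ^ d := by
  induction d with
  | zero => simp [monicsT]
  | succ d ih => simp [monicsT, ih]; ring

theorem nodup_monicsT (d : ℕ) : (monicsT d).val.Nodup := by
  induction d with
  | zero => simp [monicsT]
  | succ d ih =>
    simp only [monicsT, Timed.val_bind, consAllT_val, appendT_val]
    refine List.Nodup.append (ih.map List.cons_injective) (ih.map List.cons_injective) ?_
    intro l h₁ h₂
    simp only [List.mem_map] at h₁ h₂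
    obtain ⟨a, -, rfl⟩ := h₁
    obtain ⟨b, -, h⟩ := h₂
    simp at h

theorem monicsT_cost_le (d : ℕ) : (monicsT d).cost ≤ 7 * 2 ^ d := by
  -- The cost satisfies `T (d + 1) = T d + 3 * 2 ^ d + 4` with `T 0 = 1`; the bound is its solution.
  have key : (monicsT d).cost + 2 ≤ 3 * 2 ^ d + 4 * d := by
    induction d with
    | zero => simp [monicsT]
    | succ d ih =>
      simp only [monicsT, Timed.cost_bind, tick_cost, consAllT_cost, appendT_cost, consAllT_val,
        List.length_map, length_monicsT, pow_succ]
      omega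
  have : d < 2 ^ d := Nat.lt_two_pow_self
  omega

/-! ### Trial division -/

theorem noDivisorInT_val {e : ℕ} {L : List (List Bool)} (hL : ∀ p ∈ L, IsMonicBits e p)
    (q : List Bool) :
    (noDivisorInT q L).val = true ↔ ∀ p ∈ L, ¬ polyOfBits p ∣ polyOfBits q := by
  induction L with
  | nil => simp [noDivisorInT]
  | cons p L ih =>
    have hp := hL p (by simp)
    have ih := ih fun p hp => hL p (by simp [hp])
    have hz := (isZeroT_val (remT p q).val).trans (polyOfBits_remT_eq_zero_iff hp q)
    simp only [noDivisorInT, Timed.val_bind]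
    split_ifs with h
    · simp [hz.1 h]
    · simp [ih, mt hz.2 h]

theorem noDivisorInT_cost_le {e : ℕ} {L : List (List Bool)} (hL : ∀ p ∈ L, IsMonicBits e p)
    (q : List Bool) :
    (noDivisorInT q L).cost ≤ L.length * ((q.length + 1) * (3 * e + 7) + e + 2) + 1 := by
  induction L with
  | nil => simp [noDivisorInT]
  | cons p L ih =>
    have hp := hL p (by simp)
    have ih := ih fun p hp => hL p (by simp [hp])
    have h₁ := remT_cost_le hp q
    have h₂ := isZeroT_cost_le (remT p q).val
    rw [length_remT hp] at h₂
    simp only [noDivisorInT, Timed.cost_bind, tick_cost, List.length_cons,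
      add_one_mul L.length]
    split_ifs
    · simp only [Timed.cost_pure]
      omega
    · omega

theorem noDivisorUpToT_val (q : List Bool) (e : ℕ) :
    (noDivisorUpToT q e).val = true ↔
      ∀ p : (ZMod 2)[X], 1 ≤ p.natDegree → p.natDegree ≤ e → ¬ p ∣ polyOfBits q := by
  induction e with
  | zero =>
    simp only [noDivisorUpToT, Timed.val_bind, Timed.val_pure, true_iff]
    intro p h₁ h₂
    omega
  | succ e ih =>
    have h := noDivisorInT_val (L := (monicsT (e + 1)).val) (fun _ hp => mem_monicsT.1 hp) q
    simp only [noDivisorUpToT, Timed.val_bind]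
    split_ifs with h'
    · rw [ih]
      rw [h] at h'
      refine ⟨fun hp p h₁ h₂ hd => ?_, fun hp p h₁ h₂ => hp p h₁ (by omega)⟩
      obtain h₂ | h₂ := Nat.lt_or_eq_of_le h₂
      · exact hp p h₁ (by omega) hd
      · have h0 : p ≠ 0 := by
          rintro rfl
          simp at h₁
        refine h' (bitsOfPoly p) (mem_monicsT.2 ?_) (by simpa using hd)
        rw [← h₂]
        exact isMonicBits_bitsOfPoly h0
    · rw [h] at h'
      refine iff_of_false not_false ?_
      push Not at h'
      obtain ⟨p, hp, hd⟩ := h'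
      have := (mem_monicsT.1 hp).natDegree_eq
      exact fun hn => hn _ (by omega) (by omega) hd

/-- `M` bounds one trial division uniformly over the degrees up to `e`, so a geometric sum remains.
The `9` is `7` for listing the candidates plus `2` for loop overhead. -/
theorem noDivisorUpToT_cost_le (q : List Bool) {e M : ℕ}
    (hM : (q.length + 1) * (3 * e + 7) + e + 2 ≤ M) :
    (noDivisorUpToT q e).cost ≤ 2 ^ (e + 1) * (M + 9) := by
  induction e with
  | zero =>
    simp [noDivisorUpToT]
    omega
  | succ e ih =>
    have h := noDivisorInT_cost_le (L := (monicsT (e + 1)).val) (fun _ hp => mem_monicsT.1 hp) q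
    have hm := monicsT_cost_le (e + 1)
    have ih := ih (by nlinarith)
    have h' := h.trans (Nat.add_le_add_right (Nat.mul_le_mul_left _ hM) 1)
    rw [length_monicsT] at h'
    have h1 : 1 ≤ 2 ^ (e + 1) := Nat.one_le_two_pow
    have : (noDivisorUpToT q (e + 1)).cost ≤
        1 + ((monicsT (e + 1)).cost + ((noDivisorInT q (monicsT (e + 1)).val).cost +
          (noDivisorUpToT q e).cost)) := by
      simp only [noDivisorUpToT, Timed.cost_bind, tick_cost]
      split_ifs <;> simp
    rw [pow_succ]
    nlinarith

theorem irreducibleT_val {d : ℕ} (hd : 1 ≤ d) {q : List Bool} (hq : IsMonicBits d q) :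
    (irreducibleT d q).val = true ↔ Irreducible (polyOfBits q) := by
  have hu : ¬ IsUnit (polyOfBits q) := fun h => by
    have := natDegree_eq_zero_of_isUnit h
    have := hq.natDegree_eq
    omega
  rw [irreducibleT, noDivisorUpToT_val, irreducible_iff_lt_natDegree_lt hq.ne_zero hu,
    hq.natDegree_eq]
  constructor
  · intro h p _ hp
    rw [Finset.mem_Ioc] at hp
    exact h p hp.1 hp.2
  · intro h p h₁ h₂
    refine h p (monic_of_ne_zero ?_) (Finset.mem_Ioc.2 ⟨h₁, h₂⟩)
    rintro rfl
    simp at h₁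

theorem succ_sq_le_four_mul_two_pow (k : ℕ) : (k + 1) ^ 2 ≤ 4 * 2 ^ k := by
  induction k with
  | zero => norm_num
  | succ k ih =>
    rcases Nat.lt_or_ge k 2 with hk | hk
    · interval_cases k <;> norm_num
    · rw [pow_succ 2]
      nlinarith

/-- Trial division stops at degree `d / 2`, so there are `O(2 ^ (d / 2))` divisors at cost `O(d ^
2)` each; the square is absorbed by the unused factor `2 ^ (d - d / 2)`. -/
theorem irreducibleT_cost_le {d : ℕ} {q : List Bool} (hq : IsMonicBits d q) :
    (irreducibleT d q).cost ≤ 800 * 2 ^ d := by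
  have hdiv : d / 2 ≤ d := Nat.div_le_self d 2
  have h := noDivisorUpToT_cost_le q (e := d / 2) (M := (d + 2) * (3 * d + 7) + d + 2) (by
    rw [hq.length_eq]
    gcongr)
  obtain ⟨k, hk⟩ : ∃ k, d = d / 2 + k := ⟨d - d / 2, by omega⟩
  have hk' : d ≤ 2 * k := by omega
  have h₁ : (d + 2) * (3 * d + 7) + d + 2 + 9 ≤ 400 * 2 ^ k := by
    have := succ_sq_le_four_mul_two_pow k
    nlinarith
  calc (irreducibleT d q).cost ≤ 2 ^ (d / 2 + 1) * (400 * 2 ^ k) :=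
        h.trans (Nat.mul_le_mul_left _ h₁)
    _ = 800 * 2 ^ (d / 2 + k) := by ring
    _ = 800 * 2 ^ d := by rw [← hk]

/-! ### Searching the irreducible polynomials of a given degree -/

theorem firstCoprimeT_val {d : ℕ} (hd : 1 ≤ d) (f : List Bool) {L : List (List Bool)}
    (hL : ∀ q ∈ L, IsMonicBits d q) :
    ((firstCoprimeT d f L).val = none ∧
      ∀ q ∈ L, Irreducible (polyOfBits q) → polyOfBits q ∣ polyOfBits f) ∨
    ∃ q ∈ L, (firstCoprimeT d f L).val = some q ∧ Irreducible (polyOfBits q) ∧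
      ¬ polyOfBits q ∣ polyOfBits f := by
  induction L with
  | nil => simp [firstCoprimeT]
  | cons q L ih =>
    have hq := hL q (by simp)
    have ih := ih fun p hp => hL p (by simp [hp])
    have hz := (isZeroT_val (remT q f).val).trans (polyOfBits_remT_eq_zero_iff hq f)
    have hirr := irreducibleT_val hd hq
    simp only [firstCoprimeT, Timed.val_bind]
    simp only [List.mem_cons, forall_eq_or_imp, exists_eq_or_imp]
    split_ifs with h₁
    on_goal 1 =>
      simp only [Timed.val_bind]
      split_ifs with h₂
    · rcases ih with ⟨h, h'⟩ | h
      · exact Or.inl ⟨h, fun _ => hz.1 h₂, h'⟩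
      · exact Or.inr (Or.inr h)
    · exact Or.inr (Or.inl ⟨rfl, hirr.1 h₁, mt hz.2 h₂⟩)
    · rcases ih with ⟨h, h'⟩ | h
      · exact Or.inl ⟨h, fun hi => absurd (hirr.2 hi) h₁, h'⟩
      · exact Or.inr (Or.inr h)

/-- A search either fails, and then every irreducible polynomial of degree `d` divides `f`, or it
finds an irreducible polynomial of degree `d` that does not divide `f`. -/
theorem searchDegreeT_val {d : ℕ} (hd : 1 ≤ d) (f : List Bool) :
    ((searchDegreeT d f).val = none ∧ ∀ q : (ZMod 2)[X], Irreducible q → q.natDegree = d →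
      q ∣ polyOfBits f) ∨
    ∃ q, (searchDegreeT d f).val = some q ∧ (polyOfBits q).natDegree = d ∧
      Irreducible (polyOfBits q) ∧ ¬ polyOfBits q ∣ polyOfBits f := by
  have h := firstCoprimeT_val hd f (L := (monicsT d).val) (fun _ hp => mem_monicsT.1 hp)
  simp only [searchDegreeT, Timed.val_bind]
  rcases h with ⟨h, h'⟩ | ⟨q, hq, h, h'⟩
  · refine Or.inl ⟨h, fun q hi hq => ?_⟩
    have := h' (bitsOfPoly q) (mem_monicsT.2 (hq ▸ isMonicBits_bitsOfPoly hi.ne_zero))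
    rw [polyOfBits_bitsOfPoly] at this
    exact this hi
  · exact Or.inr ⟨q, h, (mem_monicsT.1 hq).natDegree_eq, h'⟩

-- Long divisions are made only by irreducible candidates. All of them divide `f`, except possibly
-- the one that ends the search, which accounts for the `+ 1`.
open Classical in
theorem firstCoprimeT_cost_le {d : ℕ} (hd : 1 ≤ d) (f : List Bool) {L : List (List Bool)}
    (hL : ∀ q ∈ L, IsMonicBits d q) :
    (firstCoprimeT d f L).cost ≤ L.length * (800 * 2 ^ d + 1) +
      ((L.filter fun q => Irreducible (polyOfBits q) ∧ polyOfBits q ∣ polyOfBits f).length + 1) *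
        ((f.length + 1) * (3 * d + 7) + d + 1) + 1 := by
  induction L with
  | nil => simp [firstCoprimeT]
  | cons q L ih =>
    have hq := hL q (by simp)
    have ih := ih fun p hp => hL p (by simp [hp])
    have hz := (isZeroT_val (remT q f).val).trans (polyOfBits_remT_eq_zero_iff hq f)
    have hirr := irreducibleT_val hd hq
    have h₁ := remT_cost_le hq f
    have h₂ := isZeroT_cost_le (remT q f).val
    rw [length_remT hq] at h₂
    have h₃ := irreducibleT_cost_le hq
    simp only [firstCoprimeT, Timed.cost_bind, tick_cost, List.length_cons]
    by_cases h : (irreducibleT d q).val = true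
    · by_cases h' : (isZeroT (remT q f).val).val = true
      · rw [List.filter_cons_of_pos (by simp [hirr.1 h, hz.1 h'])]
        simp only [List.length_cons, Timed.cost_bind, if_pos h, if_pos h']
        linarith
      · rw [List.filter_cons_of_neg (by simp [mt hz.2 h'])]
        simp only [Timed.cost_bind, if_pos h, if_neg h', Timed.cost_pure]
        nlinarith
    · rw [List.filter_cons_of_neg (by simp [mt hirr.2 h])]
      simp only [if_neg h]
      linarith

theorem isCoprime_polyOfBits {d : ℕ} {p q : List Bool} (hp : IsMonicBits d p)
    (hq : IsMonicBits d q) (ip : Irreducible (polyOfBits p)) (iq : Irreducible (polyOfBits q))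
    (hne : p ≠ q) : IsCoprime (polyOfBits p) (polyOfBits q) := by
  rw [ip.coprime_iff_not_dvd]
  intro h
  refine hne (polyOfBits_injective (hp.length_eq.trans hq.length_eq.symm) ?_)
  exact eq_of_monic_of_associated (monic_of_ne_zero ip.ne_zero) (monic_of_ne_zero iq.ne_zero)
    ((ip.dvd_irreducible_iff_associated iq).1 h)

-- Distinct irreducibles of degree `d` are coprime over `𝔽₂`, so the product of those dividing `f`
-- divides `f`; compare degrees.
open Classical in
theorem length_filter_irreducible_dvd_mul_le {d : ℕ} {f : List Bool} (hf : polyOfBits f ≠ 0) :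
    ((monicsT d).val.filter fun q =>
      Irreducible (polyOfBits q) ∧ polyOfBits q ∣ polyOfBits f).length * d ≤ f.length := by
  set L := (monicsT d).val.filter fun q =>
    Irreducible (polyOfBits q) ∧ polyOfBits q ∣ polyOfBits f with hL
  have hmem : ∀ q ∈ L.toFinset, IsMonicBits d q ∧ Irreducible (polyOfBits q) ∧
      polyOfBits q ∣ polyOfBits f := by
    intro q hq
    simpa [hL, mem_monicsT] using hq
  have hnd : L.Nodup := (nodup_monicsT d).filter _
  have hdvd : ∏ q ∈ L.toFinset, polyOfBits q ∣ polyOfBits f := by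
    refine Finset.prod_dvd_of_coprime ?_ fun q hq => (hmem q hq).2.2
    intro p hp q hq hne
    exact isCoprime_polyOfBits (hmem p hp).1 (hmem q hq).1 (hmem p hp).2.1 (hmem q hq).2.1 hne
  have h := natDegree_le_of_dvd hdvd hf
  rw [natDegree_prod _ _ fun q hq => (hmem q hq).1.ne_zero,
    Finset.sum_congr rfl fun q hq => (hmem q hq).1.natDegree_eq, Finset.sum_const,
    List.toFinset_card_of_nodup hnd, smul_eq_mul] at h
  exact h.trans (natDegree_polyOfBits_lt hf).le

/-- The `m` successful divisions satisfy `m * d ≤ 2 ^ d`, which cancels the factor `d` in the cost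
`O(d * 2 ^ d)` of a division. -/
theorem searchDegreeT_cost_le {d : ℕ} (hd : 1 ≤ d) {f : List Bool} (hf : polyOfBits f ≠ 0)
    (hlen : f.length ≤ 2 ^ d) : (searchDegreeT d f).cost ≤ 860 * 4 ^ d := by
  classical
  have h₁ := firstCoprimeT_cost_le hd f (L := (monicsT d).val) (fun _ hp => mem_monicsT.1 hp)
  have h₂ := length_filter_irreducible_dvd_mul_le (d := d) hf
  have h₃ := monicsT_cost_le d
  set m := ((monicsT d).val.filter fun q =>
    Irreducible (polyOfBits q) ∧ polyOfBits q ∣ polyOfBits f).length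
  rw [length_monicsT] at h₁
  have hd2 : d < 2 ^ d := Nat.lt_two_pow_self
  have h4 : 4 ^ d = 2 ^ d * 2 ^ d := by rw [← mul_pow]; norm_num
  simp only [searchDegreeT, Timed.cost_bind]
  rw [h4]
  set t := 2 ^ d
  have h₅ : (f.length + 1) * (3 * d + 7) + d + 1 ≤ 22 * t * d := by
    have : (f.length + 1) * (3 * d + 7) ≤ (2 * t) * (10 * d) := by gcongr <;> omega
    nlinarith
  have h₆ : (m + 1) * ((f.length + 1) * (3 * d + 7) + d + 1) ≤ 44 * (t * t) := by
    calc (m + 1) * ((f.length + 1) * (3 * d + 7) + d + 1) ≤ (m + 1) * (22 * t * d) := by gcongr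
      _ = 22 * t * (m * d + d) := by ring
      _ ≤ 22 * t * (t + t) := by gcongr; omega
      _ = 44 * (t * t) := by ring
  nlinarith

open Classical in
theorem le_firstCoprimeT_cost {d : ℕ} (hd : 1 ≤ d) {f : List Bool} {L : List (List Bool)}
    (hL : ∀ q ∈ L, IsMonicBits d q)
    (hf : ∀ q ∈ L, Irreducible (polyOfBits q) → polyOfBits q ∣ polyOfBits f) :
    (L.filter fun q => Irreducible (polyOfBits q)).length * (f.length * d) ≤
      (firstCoprimeT d f L).cost := by
  induction L with
  | nil => simp
  | cons q L ih =>
    have hq := hL q (by simp)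
    have ih := ih (fun p hp => hL p (by simp [hp])) fun p hp => hf p (by simp [hp])
    have hz := (isZeroT_val (remT q f).val).trans (polyOfBits_remT_eq_zero_iff hq f)
    have hirr := irreducibleT_val hd hq
    have h₁ := le_remT_cost hq f
    simp only [firstCoprimeT, Timed.cost_bind, tick_cost]
    split_ifs with h
    · have h' := hz.2 (hf q (by simp) (hirr.1 h))
      rw [List.filter_cons_of_pos (by simp [hirr.1 h])]
      simp only [List.length_cons, Timed.cost_bind, if_pos h']
      linarith
    · rw [List.filter_cons_of_neg (by simp [mt hirr.2 h])]
      omega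

/-! ### The polynomial `X ^ (2 ^ n) + X` -/

theorem irreducible_dvd_X_pow_sub_X_iff {q : (ZMod 2)[X]} (hq : Irreducible q) (n : ℕ) :
    q ∣ X ^ 2 ^ n - X ↔ q.natDegree ∣ n := by
  have := hq.natDegree_dvd_iff_dvd_X_pow_card_pow_sub_X (n := n)
  rw [Nat.card_zmod] at this
  exact this.symm

theorem natDegree_X_pow_sub_X {n : ℕ} (hn : 1 ≤ n) :
    (X ^ 2 ^ n - X : (ZMod 2)[X]).natDegree = 2 ^ n :=
  FiniteField.X_pow_card_pow_sub_X_natDegree_eq _ (by omega) one_lt_two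

theorem X_pow_sub_X_ne_zero {n : ℕ} (hn : 1 ≤ n) : (X ^ 2 ^ n - X : (ZMod 2)[X]) ≠ 0 :=
  FiniteField.X_pow_card_pow_sub_X_ne_zero _ (by omega) one_lt_two

theorem squarefree_X_pow_sub_X {n : ℕ} (hn : 1 ≤ n) :
    Squarefree (X ^ 2 ^ n - X : (ZMod 2)[X]) :=
  (galois_poly_separable 2 (2 ^ n) (dvd_pow_self 2 (by omega))).squarefree

open UniqueFactorizationMonoid in
/-- A squarefree polynomial divides everything that is divisible by its irreducible factors. -/
theorem dvd_of_forall_irreducible_dvd {p f : (ZMod 2)[X]} (hp : Squarefree p)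
    (h : ∀ q, Irreducible q → q ∣ p → q ∣ f) : p ∣ f := by
  classical
  by_cases hf : f = 0
  · simp [hf]
  have h0 : p ≠ 0 := hp.ne_zero
  -- Squarefreeness makes the factor multiset duplicate-free, so multiplicities in `f` do not
  -- matter.
  rw [dvd_iff_normalizedFactors_le_normalizedFactors h0 hf,
    Multiset.le_iff_subset ((squarefree_iff_nodup_normalizedFactors h0).1 hp)]
  intro q hq
  obtain ⟨hi, hm, hd⟩ := (Polynomial.mem_normalizedFactors_iff h0).1 hq
  exact (Polynomial.mem_normalizedFactors_iff hf).2 ⟨hi, hm, h q hi hd⟩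

open Classical in
/-- The degrees of the irreducible polynomials of degree at most `n` add up to at least `2 ^ n`. -/
theorem two_pow_le_sum_irreducible {n : ℕ} (hn : 1 ≤ n) :
    2 ^ n ≤ ∑ k ∈ Finset.range n,
      ((monicsT (1 + k)).val.filter fun q => Irreducible (polyOfBits q)).length * (1 + k) := by
  set S : ℕ → Finset (List Bool) := fun k =>
    ((monicsT (1 + k)).val.filter fun q => Irreducible (polyOfBits q)).toFinset with hS
  have hmem : ∀ k, ∀ q ∈ S k, IsMonicBits (1 + k) q ∧ Irreducible (polyOfBits q) := by
    intro k q hq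
    simpa [hS, mem_monicsT] using hq
  have h0 : ∏ k ∈ Finset.range n, ∏ q ∈ S k, polyOfBits q ≠ 0 :=
    Finset.prod_ne_zero_iff.2 fun k _ => Finset.prod_ne_zero_iff.2 fun q hq =>
      (hmem k q hq).2.ne_zero
  have hdvd : (X ^ 2 ^ n - X : (ZMod 2)[X]) ∣
      ∏ k ∈ Finset.range n, ∏ q ∈ S k, polyOfBits q := by
    refine dvd_of_forall_irreducible_dvd (squarefree_X_pow_sub_X hn) fun q hq hd => ?_
    have h₁ := Nat.le_of_dvd (by omega) ((irreducible_dvd_X_pow_sub_X_iff hq n).1 hd)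
    have h₂ := hq.natDegree_pos
    have hk : 1 + (q.natDegree - 1) = q.natDegree := by omega
    have hqS : bitsOfPoly q ∈ S (q.natDegree - 1) := by
      simp only [hS, List.mem_toFinset, List.mem_filter, mem_monicsT, hk,
        polyOfBits_bitsOfPoly, decide_eq_true_eq]
      exact ⟨isMonicBits_bitsOfPoly hq.ne_zero, hq⟩
    calc q = polyOfBits (bitsOfPoly q) := (polyOfBits_bitsOfPoly q).symm
      _ ∣ ∏ q ∈ S (q.natDegree - 1), polyOfBits q := Finset.dvd_prod_of_mem _ hqS
      _ ∣ _ := Finset.dvd_prod_of_mem (fun k => ∏ q ∈ S k, polyOfBits q)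
        (Finset.mem_range.2 (by omega))
  have h := natDegree_le_of_dvd hdvd h0
  rw [natDegree_X_pow_sub_X hn, natDegree_prod _ _ (Finset.prod_ne_zero_iff.1 h0)] at h
  refine h.trans (Finset.sum_le_sum fun k _ => ?_)
  rw [natDegree_prod _ _ fun q hq => (hmem k q hq).2.ne_zero,
    Finset.sum_congr rfl fun q hq => (hmem k q hq).1.natDegree_eq, Finset.sum_const,
    List.toFinset_card_of_nodup ((nodup_monicsT _).filter _), smul_eq_mul]

/-! ### The two algorithms -/

/-- The folded list has at most `2 ^ i` bits, so it is a genuine remainder. -/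
theorem polyOfBits_reduceT_eq_zero_iff {i : ℕ} (hi : 1 ≤ i) (f : List Bool) :
    polyOfBits (reduceT i f).val = 0 ↔ (X ^ 2 ^ i - X : (ZMod 2)[X]) ∣ polyOfBits f := by
  have h := X_pow_sub_X_dvd_reduceT hi f
  constructor
  · intro h0
    simpa [h0] using h
  · intro hd
    refine eq_zero_of_dvd_of_degree_lt ((dvd_sub_right hd).1 h) ?_
    rw [degree_eq_natDegree (X_pow_sub_X_ne_zero hi), natDegree_X_pow_sub_X hi]
    exact (degree_polyOfBits_lt _).trans_le (by exact_mod_cast length_reduceT_le i f)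

/-- `hf` is the loop invariant; it makes the degree found least, and shows that a nonzero remainder
can only be due to degree `i`. -/
theorem fastLoopT_val (f : List Bool) (n i : ℕ) (hi : 1 ≤ i)
    (hf : ∀ q : (ZMod 2)[X], Irreducible q → q.natDegree < i → q ∣ polyOfBits f) :
    ((fastLoopT f n i).val = none ∧ ∀ q : (ZMod 2)[X], Irreducible q → q.natDegree < i + n →
      q ∣ polyOfBits f) ∨
    ∃ q, (fastLoopT f n i).val = some q ∧ (polyOfBits q).natDegree < i + n ∧
      Irreducible (polyOfBits q) ∧ ¬ polyOfBits q ∣ polyOfBits f ∧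
      ∀ p : (ZMod 2)[X], Irreducible p → p.natDegree < (polyOfBits q).natDegree →
        p ∣ polyOfBits f := by
  induction n generalizing i with
  | zero => exact Or.inl ⟨rfl, hf⟩
  | succ n ih =>
    have hz := (isZeroT_val (reduceT i f).val).trans (polyOfBits_reduceT_eq_zero_iff hi f)
    have hr := X_pow_sub_X_dvd_reduceT hi f
    simp only [fastLoopT, Timed.val_bind]
    split_ifs with h
    · rw [← add_assoc, add_right_comm]
      refine ih (i + 1) (by omega) fun q hq hlt => ?_
      obtain hlt | heq := Nat.lt_or_eq_of_le (Nat.lt_succ_iff.1 hlt)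
      · exact hf q hq hlt
      · exact ((irreducible_dvd_X_pow_sub_X_iff hq i).2 heq.dvd).trans (hz.1 h)
    · have hiff : ∀ q : (ZMod 2)[X], Irreducible q → q.natDegree = i →
          (q ∣ polyOfBits (reduceT i f).val ↔ q ∣ polyOfBits f) := fun q hq heq =>
        ((dvd_iff_dvd_of_dvd_sub
          (((irreducible_dvd_X_pow_sub_X_iff hq i).2 heq.dvd).trans hr))).symm
      rcases searchDegreeT_val hi (reduceT i f).val with ⟨-, hs⟩ | ⟨q, h₁, h₂, h₃, h₄⟩
      -- The search cannot fail: otherwise all irreducible factors of `X ^ 2 ^ i - X` would divide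
      -- `f`, and the remainder would be zero.
      · refine absurd (hz.2 ?_) h
        refine dvd_of_forall_irreducible_dvd (squarefree_X_pow_sub_X hi) fun q hq hd => ?_
        have hle := Nat.le_of_dvd (by omega) ((irreducible_dvd_X_pow_sub_X_iff hq i).1 hd)
        obtain hlt | heq := Nat.lt_or_eq_of_le hle
        · exact hf q hq hlt
        · exact (hiff q hq heq).1 (hs q hq heq)
      · exact Or.inr ⟨q, h₁, by omega, h₃, mt (hiff _ h₃ h₂).2 h₄, by rwa [h₂]⟩

theorem isLeastCoprime_fastCoprime (N : ℕ) (f : (ZMod 2)[X]) :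
    IsLeastCoprime N f (fastCoprime N (bitsOfPoly f)).val := by
  have h := fastLoopT_val (bitsOfPoly f) (Nat.clog 2 N) 1 le_rfl fun q hq hlt => by
    have := hq.natDegree_pos
    omega
  rw [polyOfBits_bitsOfPoly] at h
  rw [fastCoprime]
  rcases h with ⟨h, h'⟩ | ⟨q, h, h₁, h₂, h₃, h₄⟩
  · rw [h]
    intro q hq hd
    rw [hq.coprime_iff_not_dvd, not_not]
    exact h' q hq (by omega)
  · rw [h]
    refine ⟨by omega, h₂, h₂.coprime_iff_not_dvd.2 h₃, fun p hp hc => ?_⟩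
    by_contra hlt
    exact hp.coprime_iff_not_dvd.1 hc (h₄ p hp (by omega))

/-- The search ends the loop, so its cost is paid once and stays outside the factor `n`. -/
theorem fastLoopT_cost_le (f : List Bool) (n i B : ℕ) (hi : 1 ≤ i) (hB : i + n ≤ B + 1) :
    (fastLoopT f n i).cost ≤ n * (6 * f.length + 2 ^ B + 5) + 860 * 4 ^ B + 1 := by
  induction n generalizing i with
  | zero => simp [fastLoopT]
  | succ n ih =>
    have h₁ := reduceT_cost_le hi f
    have h₂ := isZeroT_cost_le (reduceT i f).val
    have h₃ := length_reduceT_le i f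
    have h₄ : 2 ^ i ≤ 2 ^ B := Nat.pow_le_pow_right (by norm_num) (by omega)
    have h₅ : 4 ^ i ≤ 4 ^ B := Nat.pow_le_pow_right (by norm_num) (by omega)
    simp only [fastLoopT, Timed.cost_bind, tick_cost]
    split_ifs with h
    · have := ih (i + 1) (by omega) (by omega)
      rw [add_mul n 1]
      omega
    · have := searchDegreeT_cost_le hi (mt (isZeroT_val _).2 h) h₃
      rw [add_mul n 1]
      omega

theorem fastCoprime_cost_le (N : ℕ) (f : List Bool) :
    (fastCoprime N f).cost ≤
      Nat.clog 2 N * (6 * f.length + 2 ^ Nat.clog 2 N + 5) + 860 * 4 ^ Nat.clog 2 N + 1 :=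
  fastLoopT_cost_le f _ _ _ le_rfl (by omega)

open Classical in
theorem le_bruteLoopT_cost (f : List Bool) (n i : ℕ) (hi : 1 ≤ i)
    (hf : ∀ q : (ZMod 2)[X], Irreducible q → q.natDegree < i + n → q ∣ polyOfBits f) :
    ∑ k ∈ Finset.range n,
      ((monicsT (i + k)).val.filter fun q => Irreducible (polyOfBits q)).length *
        (f.length * (i + k)) ≤ (bruteLoopT f n i).cost := by
  induction n generalizing i with
  | zero => simp
  | succ n ih =>
    have h₁ := le_firstCoprimeT_cost hi (f := f) (L := (monicsT i).val)
      (fun _ hp => mem_monicsT.1 hp) fun q hq hi =>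
        hf _ hi (by rw [(mem_monicsT.1 hq).natDegree_eq]; omega)
    have h₂ := ih (i + 1) (by omega) fun q hq hlt => hf q hq (by omega)
    rw [Finset.sum_range_succ', add_zero]
    rcases searchDegreeT_val hi f with ⟨hs, -⟩ | ⟨q, -, hs, hq, hnd⟩
    · simp only [bruteLoopT, Timed.cost_bind, tick_cost, hs]
      simp only [searchDegreeT, Timed.cost_bind]
      rw [Finset.sum_congr rfl fun k _ => by rw [show i + (k + 1) = i + 1 + k by omega]]
      omega
    · exact absurd (hf _ hq (by omega)) hnd

theorem le_bruteCoprime_cost {N : ℕ} (hN : 2 ≤ N) {f : List Bool}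
    (hf : ∀ q : (ZMod 2)[X], Irreducible q → q.natDegree ≤ Nat.clog 2 N → q ∣ polyOfBits f) :
    f.length * 2 ^ Nat.clog 2 N ≤ (bruteCoprime N f).cost := by
  classical
  refine le_trans ?_ (le_bruteLoopT_cost f (Nat.clog 2 N) 1 le_rfl fun q hq hlt =>
    hf q hq (by omega))
  refine (Nat.mul_le_mul_left _ (two_pow_le_sum_irreducible (Nat.clog_pos one_lt_two hN))).trans ?_
  rw [Finset.mul_sum]
  refine Finset.sum_le_sum fun k _ => le_of_eq ?_
  ring

/-! ### Walks in acyclic multigraphs -/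

theorem DirMultigraph.isWalk_append {V E : Type*} (G : DirMultigraph V E) {u v : V}
    {p q : List E} : G.IsWalk u (p ++ q) v ↔ ∃ w, G.IsWalk u p w ∧ G.IsWalk w q v := by
  induction p generalizing u with
  | nil => simp [IsWalk]
  | cons e p ih => simp [IsWalk, ih, and_assoc]

namespace MulticastNetwork

variable {V E : Type*} {G : MulticastNetwork V E}

/-- A repeated edge would close a directed cycle. Hence walks have at most `Fintype.card E` edges.
-/
theorem nodup_of_isWalk {u v : V} {p : List E} (h : G.IsWalk u p v) : p.Nodup := by
  induction p generalizing u with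
  | nil => simp
  | cons e p ih =>
    refine List.nodup_cons.2 ⟨fun he => ?_, ih h.2⟩
    obtain ⟨s, t, rfl⟩ := List.append_of_mem he
    obtain ⟨w, hs, ht⟩ := G.isWalk_append.1 h.2
    obtain rfl : G.src e = w := ht.1
    exact List.cons_ne_nil _ _ (G.acyclic (G.src e) (e :: s) ⟨rfl, hs⟩)

theorem length_le_card_of_isWalk [Fintype E] {u v : V} {p : List E} (h : G.IsWalk u p v) :
    p.length ≤ Fintype.card E :=
  (nodup_of_isWalk h).length_le_card

theorem length_le_longestPath [Fintype E] {T : V} (hT : T ∈ G.sinks) {p : List E}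
    (h : G.IsWalk G.source p T) : p.length ≤ G.longestPath := by
  -- Boundedness matters: on `ℕ` the supremum of an unbounded set is `0`.
  refine le_csSup ⟨Fintype.card E, ?_⟩ ⟨T, hT, p, h, rfl⟩
  rintro n ⟨T, -, p, hp, rfl⟩
  exact length_le_card_of_isWalk hp

theorem one_le_longestPath [Fintype E] (h : 1 ≤ G.minCut) : 1 ≤ G.longestPath := by
  obtain ⟨T, hT⟩ := G.sinks_nonempty
  have hcap : 1 ≤ G.unicastCapacity T := h.trans (Finset.inf'_le _ hT)
  by_cases hw : ∃ p, G.IsWalk G.source p T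
  · obtain ⟨p, hp⟩ := hw
    refine le_trans ?_ (length_le_longestPath hT hp)
    cases p with
    | nil =>
      obtain rfl : G.source = T := hp
      exact absurd hT G.source_notMem
    | cons e p => simp
  · have : G.unicastCapacity T ≤ 0 := by
      refine csSup_le' ?_
      rintro n ⟨p, hp, -⟩
      by_contra hn
      exact hw ⟨_, hp ⟨0, by omega⟩⟩
    omega

/-! ### The degree of the product of the determinants -/

variable {d : ℕ} [Fintype E] [DecidableEq E]

/-- A nonzero entry of `K ^ n` comes from a chain of consecutive edges. The walk stops before `e'`,
which is appended later as the edge entering the sink. -/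
theorem exists_isWalk_of_pow_ne_zero {R : Type*} [CommRing R] (c : G.Code R d) {n : ℕ}
    {e e' : E} (h : (c.K ^ n) e e' ≠ 0) :
    ∃ p : List E, p.length = n ∧ G.IsWalk (G.src e) p (G.src e') := by
  induction n generalizing e with
  | zero =>
    rw [pow_zero, Matrix.one_apply] at h
    obtain rfl : e = e' := by
      by_contra hne
      simp [hne] at h
    exact ⟨[], rfl, rfl⟩
  | succ n ih =>
    rw [pow_succ', Matrix.mul_apply] at h
    obtain ⟨f, -, hf⟩ := Finset.exists_ne_zero_of_sum_ne_zero h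
    obtain ⟨p, rfl, hp⟩ := ih (right_ne_zero_of_mul hf)
    have ht : G.tgt e = G.src f := by
      by_contra hne
      exact left_ne_zero_of_mul hf (c.K_supp e f hne)
    exact ⟨e :: p, rfl, rfl, ht ▸ hp⟩

theorem Code.pow_card_succ_eq_zero {R : Type*} [CommRing R] (c : G.Code R d) :
    c.K ^ (Fintype.card E + 1) = 0 := by
  ext e e'
  by_contra h
  obtain ⟨p, hp, hw⟩ := exists_isWalk_of_pow_ne_zero c h
  have := length_le_card_of_isWalk hw
  omega

theorem Code.inv_one_sub_eq_sum {R : Type*} [CommRing R] (c : G.Code R d) :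
    (1 - c.K)⁻¹ = ∑ n ∈ Finset.range (Fintype.card E + 1), c.K ^ n := by
  refine Matrix.inv_eq_right_inv ?_
  rw [mul_neg_geom_sum, c.pow_card_succ_eq_zero, sub_zero]

theorem natDegree_matrix_pow_le {S : Type*} [CommRing S] {M : Matrix E E S[X]} {b : ℕ}
    (hM : ∀ e e', (M e e').natDegree ≤ b) (n : ℕ) (e e' : E) :
    ((M ^ n) e e').natDegree ≤ n * b := by
  induction n generalizing e with
  | zero =>
    rw [pow_zero, Matrix.one_apply]
    split_ifs <;> simp
  | succ n ih =>
    rw [pow_succ', Matrix.mul_apply]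
    refine natDegree_sum_le_of_forall_le _ _ fun f _ => natDegree_mul_le.trans ?_
    rw [add_one_mul, add_comm]
    exact add_le_add (ih f) (hM e f)

theorem natDegree_det_le {S : Type*} [CommRing S] {M : Matrix (Fin d) (Fin d) S[X]} {b : ℕ}
    (hM : ∀ i j, (M i j).natDegree ≤ b) : M.det.natDegree ≤ d * b := by
  rw [Matrix.det_apply']
  refine natDegree_sum_le_of_forall_le _ _ fun σ _ => natDegree_mul_le.trans ?_
  rw [natDegree_intCast, zero_add]
  refine (natDegree_prod_le _ _).trans ((Finset.sum_le_sum fun i _ => hM (σ i) i).trans ?_)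
  simp

/-- A nonzero term with `K ^ n` yields a walk of `n + 1 ≤ Λ` edges and is a product with degree at
most `b + n * b + b`. -/
theorem Code.DegreeLE.natDegree_transfer_le {c : G.Code (ZMod 2)[X] d} {b : ℕ}
    (hc : c.DegreeLE b) {T : V} (hT : T ∈ G.sinks) (i j : Fin d) :
    (c.transfer T i j).natDegree ≤ (G.longestPath + 1) * b := by
  rw [transfer, c.inv_one_sub_eq_sum, Matrix.mul_sum, Matrix.sum_mul, Matrix.sum_apply]
  refine natDegree_sum_le_of_forall_le _ _ fun n _ => ?_
  rw [Matrix.mul_apply]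
  refine natDegree_sum_le_of_forall_le _ _ fun e' _ => ?_
  rw [Matrix.mul_apply, Finset.sum_mul]
  refine natDegree_sum_le_of_forall_le _ _ fun e _ => ?_
  by_cases h : c.A i e * (c.K ^ n) e e' * c.D T e' j = 0
  · simp [h]
  · have hs : G.src e = G.source := by
      by_contra hne
      simp [c.A_supp i e hne] at h
    have ht : G.tgt e' = T := by
      by_contra hne
      simp [c.D_supp T e' j hne] at h
    obtain ⟨p, rfl, hp⟩ :=
      exists_isWalk_of_pow_ne_zero c (right_ne_zero_of_mul (left_ne_zero_of_mul h))
    rw [hs] at hp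
    have hlen := length_le_longestPath hT (G.isWalk_append.2 ⟨_, hp, rfl, ht⟩ :
      G.IsWalk G.source (p ++ [e']) T)
    rw [List.length_append, List.length_singleton] at hlen
    calc (c.A i e * (c.K ^ p.length) e e' * c.D T e' j).natDegree
        ≤ (b + p.length * b) + b :=
          natDegree_mul_le.trans (add_le_add (natDegree_mul_le.trans
            (add_le_add (hc.1 i e) (natDegree_matrix_pow_le hc.2.1 _ e e'))) (hc.2.2 T e' j))
      _ = (p.length + 1 + 1) * b := by ring
      _ ≤ (G.longestPath + 1) * b := by gcongr

theorem Code.DegreeLE.natDegree_detProd_le {c : G.Code (ZMod 2)[X] d} {b : ℕ}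
    (hc : c.DegreeLE b) (hd : d ≤ G.minCut) :
    c.detProd.natDegree ≤ G.sinks.card * b * G.minCut * (2 * G.longestPath) := by
  have h₁ : c.detProd.natDegree ≤ G.sinks.card * (d * ((G.longestPath + 1) * b)) := by
    refine (natDegree_prod_le _ _).trans ?_
    rw [← smul_eq_mul]
    exact Finset.sum_le_card_nsmul _ _ _ fun T hT =>
      natDegree_det_le (hc.natDegree_transfer_le hT)
  -- For `d ≥ 1` the longest path is nonempty, so `Λ + 1 ≤ 2 * Λ`; the general bound then applies
  -- with `2 * Λ` for `Λ`.
  have h₂ : d * (G.longestPath + 1) ≤ G.minCut * (2 * G.longestPath) := by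
    rcases Nat.eq_zero_or_pos d with rfl | hpos
    · simp
    · have := one_le_longestPath (Nat.le_trans hpos hd)
      exact Nat.mul_le_mul hd (by omega)
  calc c.detProd.natDegree ≤ G.sinks.card * b * (d * (G.longestPath + 1)) := by
        convert h₁ using 1; ring
    _ ≤ G.sinks.card * b * (G.minCut * (2 * G.longestPath)) := by gcongr
    _ = _ := by ring

end MulticastNetwork

/-! ### Asymptotic bounds -/

theorem two_pow_clog_le {N : ℕ} (hN : 1 ≤ N) : 2 ^ Nat.clog 2 N ≤ 2 * N := by
  rcases Nat.eq_or_lt_of_le hN with rfl | hN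
  · simp
  · have h₁ := Nat.pow_pred_clog_lt_self one_lt_two hN
    obtain ⟨k, hk⟩ := Nat.exists_eq_succ_of_ne_zero (Nat.clog_pos one_lt_two hN).ne'
    rw [hk] at h₁ ⊢
    simp only [Nat.pred_succ, Nat.succ_eq_add_one, pow_succ] at h₁ ⊢
    omega

theorem fastCoprime_bitsOfPoly_cost_le {N D : ℕ} (hN : 1 ≤ N) {f : (ZMod 2)[X]}
    (hf : f.natDegree ≤ D) :
    (fastCoprime N (bitsOfPoly f)).cost ≤ 6 * Nat.clog 2 N * D + 3500 * N ^ 2 := by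
  have h := fastCoprime_cost_le N (bitsOfPoly f)
  have ht := two_pow_clog_le hN
  have hL : Nat.clog 2 N < 2 ^ Nat.clog 2 N := Nat.lt_two_pow_self
  have h4 : 4 ^ Nat.clog 2 N = 2 ^ Nat.clog 2 N * 2 ^ Nat.clog 2 N := by rw [← mul_pow]; norm_num
  rw [length_bitsOfPoly, h4] at h
  set t := 2 ^ Nat.clog 2 N
  set L := Nat.clog 2 N
  have h₁ : L * (6 * (f.natDegree + 1) + t + 5) ≤ 6 * L * D + 12 * (t * t) := by
    have h₂ : L * f.natDegree ≤ L * D := Nat.mul_le_mul_left _ hf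
    have h₃ : L * t ≤ t * t := Nat.mul_le_mul_right _ hL.le
    have h₅ : t ≤ t * t := Nat.le_mul_self t
    nlinarith
  have h₂ : t * t ≤ 2 * N * (2 * N) := Nat.mul_le_mul ht ht
  nlinarith

theorem logb_le_clog (N : ℕ) : Real.logb 2 N ≤ Nat.clog 2 N := by
  have := Real.natCeil_logb_natCast 2 N
  rw [← this]
  exact Nat.le_ceil _

theorem clog_le_two_mul_logb {N : ℕ} (hN : 1 ≤ N) : (Nat.clog 2 N : ℝ) ≤ 2 * Real.logb 2 N := by
  rcases Nat.eq_or_lt_of_le hN with rfl | hN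
  · simp
  · have h₁ : 1 ≤ Real.logb 2 N := by
      rw [Real.le_logb_iff_rpow_le one_lt_two (by positivity), Real.rpow_one]
      exact_mod_cast hN
    have h₂ := Nat.ceil_lt_add_one (zero_le_one.trans h₁)
    have h₃ := Real.natCeil_logb_natCast 2 N
    push_cast at h₃
    rw [h₃] at h₂
    linarith

theorem fastCoprime_cost_le_of_natDegree_le {N h Λ : ℕ} {f : (ZMod 2)[X]} (hN : 1 ≤ N)
    (hf : f.natDegree ≤ N * Nat.clog 2 N * h * Λ) :
    ((fastCoprime N (bitsOfPoly f)).cost : ℝ) ≤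
      3500 * (N : ℝ) ^ 2 + 24 * (h * N * (Real.logb 2 N) ^ 2 * Λ) := by
  have h₁ := fastCoprime_bitsOfPoly_cost_le hN hf
  have h₂ : ((fastCoprime N (bitsOfPoly f)).cost : ℝ) ≤
      6 * Nat.clog 2 N * (N * Nat.clog 2 N * h * Λ) + 3500 * (N : ℝ) ^ 2 := by exact_mod_cast h₁
  have h₃ : (Nat.clog 2 N : ℝ) ^ 2 ≤ (2 * Real.logb 2 N) ^ 2 := by
    have := clog_le_two_mul_logb hN
    gcongr
  have h₄ := mul_le_mul_of_nonneg_left h₃ (by positivity : (0 : ℝ) ≤ 6 * (N * h * Λ))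
  linarith

/-- For large `N`, the logarithm of `N` is large but small compared to `N`. -/
theorem exists_forall_le_logb_and_logb_le (M : ℝ) {δ : ℝ} (hδ : 0 < δ) :
    ∃ N₀ : ℕ, ∀ N : ℕ, N₀ ≤ N → M ≤ Real.logb 2 N ∧ Real.logb 2 N ≤ δ * N := by
  have h₁ := ((Real.tendsto_logb_atTop one_lt_two).comp
    tendsto_natCast_atTop_atTop).eventually_ge_atTop M
  have h₂ := (Real.isLittleO_log_id_atTop.comp_tendsto
    (tendsto_natCast_atTop_atTop (R := ℝ))).bound
    (mul_pos hδ (Real.log_pos one_lt_two))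
  obtain ⟨N₀, h⟩ := Filter.eventually_atTop.1 (h₁.and h₂)
  refine ⟨N₀, fun N hN => ⟨(h N hN).1, ?_⟩⟩
  have h₃ := (le_abs_self _).trans (h N hN).2
  simp only [Function.comp_apply, id, Real.norm_natCast] at h₃
  rw [Real.logb, div_le_iff₀ (Real.log_pos one_lt_two)]
  linarith

/-- A polynomial of prescribed degree that is divisible by all irreducible polynomials of degree
at most `L`. -/
theorem exists_natDegree_eq_forall_irreducible_dvd {L D : ℕ} (hD : 2 ^ (L + 1) ≤ D) :
    ∃ f : (ZMod 2)[X], f ≠ 0 ∧ f.natDegree = D ∧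
      ∀ q : (ZMod 2)[X], Irreducible q → q.natDegree ≤ L → q ∣ f := by
  have h0 : ∀ i ∈ Finset.range L, (X ^ 2 ^ (i + 1) - X : (ZMod 2)[X]) ≠ 0 :=
    fun i _ => X_pow_sub_X_ne_zero (by omega)
  have hp0 := Finset.prod_ne_zero_iff.2 h0
  have hdeg : (∏ i ∈ Finset.range L, (X ^ 2 ^ (i + 1) - X : (ZMod 2)[X])).natDegree ≤ D := by
    refine le_trans ?_ hD
    rw [natDegree_prod _ _ h0, Finset.sum_congr rfl fun i _ => natDegree_X_pow_sub_X (by omega)]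
    clear h0 hp0 hD
    have : ∑ i ∈ Finset.range L, 2 ^ (i + 1) + 2 = 2 ^ (L + 1) := by
      induction L with
      | zero => simp
      | succ L ih =>
        rw [Finset.sum_range_succ, pow_succ 2 (L + 1)]
        omega
    omega
  refine ⟨X ^ (D - (∏ i ∈ Finset.range L, (X ^ 2 ^ (i + 1) - X : (ZMod 2)[X])).natDegree) *
    ∏ i ∈ Finset.range L, (X ^ 2 ^ (i + 1) - X), mul_ne_zero (pow_ne_zero _ X_ne_zero) hp0, ?_, ?_⟩
  · rw [natDegree_mul (pow_ne_zero _ X_ne_zero) hp0, natDegree_X_pow]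
    omega
  · intro q hq hle
    have := hq.natDegree_pos
    refine Dvd.dvd.mul_left (((irreducible_dvd_X_pow_sub_X_iff hq (q.natDegree - 1 + 1)).2
      (by rw [Nat.sub_add_cancel this])).trans ?_) _
    exact Finset.dvd_prod_of_mem (fun i => (X ^ 2 ^ (i + 1) - X : (ZMod 2)[X]))
      (Finset.mem_range.2 (by omega))

theorem fastCoprime_cost_le_mul_bruteCoprime_cost {ε : ℝ} (hε : 0 < ε) :
    ∃ N₀ : ℕ, ∀ N h Λ : ℕ, N₀ ≤ N → 1 ≤ h → 1 ≤ Λ →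
      ∃ f : (ZMod 2)[X], f ≠ 0 ∧ f.natDegree ≤ N * Nat.clog 2 N * h * Λ ∧
        ∀ f' : (ZMod 2)[X], f'.natDegree ≤ N * Nat.clog 2 N * h * Λ →
          ((fastCoprime N (bitsOfPoly f')).cost : ℝ) ≤
            ε * ((bruteCoprime N (bitsOfPoly f)).cost : ℝ) := by
  -- Each half of `ε * D * N` absorbs one term: `δ = ε / 24` gives `12 * L ≤ ε * N` for `6 * L * D`,
  -- and `7000 / ε` handles `3500 * N ^ 2` through `D ≥ N * L`. The `4` ensures `2 ^ (L + 1) ≤ 4 * N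
  -- ≤ D`, so that a suitable `f` exists.
  obtain ⟨N₀, hN₀⟩ := exists_forall_le_logb_and_logb_le (max 4 (7000 / ε)) (δ := ε / 24)
    (by positivity)
  refine ⟨N₀, fun N h Λ hN hh hΛ => ?_⟩
  obtain ⟨h₁, h₂⟩ := hN₀ N hN
  have hlog : 4 ≤ Real.logb 2 N := (le_max_left _ _).trans h₁
  have hN2 : 2 ≤ N := by
    by_contra hlt
    interval_cases N <;> norm_num at hlog
  have hL4 : 4 ≤ Nat.clog 2 N := by exact_mod_cast hlog.trans (logb_le_clog N)
  have hLε : 7000 ≤ ε * Nat.clog 2 N := by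
    have := ((le_max_right _ _).trans h₁).trans (logb_le_clog N)
    rw [div_le_iff₀ hε] at this
    linarith
  have hLN : 12 * (Nat.clog 2 N : ℝ) ≤ ε * N := by
    have := clog_le_two_mul_logb (N := N) (by omega)
    linarith
  have hpow := two_pow_clog_le (N := N) (by omega)
  have hNpow : N ≤ 2 ^ Nat.clog 2 N := Nat.le_pow_clog one_lt_two N
  have hP : 1 ≤ h * Λ := Nat.mul_pos hh hΛ
  set L := Nat.clog 2 N with hL
  have hND : N * L ≤ N * L * h * Λ := by
    rw [mul_assoc (N * L)]
    exact Nat.le_mul_of_pos_right _ hP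
  set D := N * L * h * Λ
  obtain ⟨f, hf0, hfD, hf⟩ := exists_natDegree_eq_forall_irreducible_dvd (L := L) (D := D) (by
    rw [pow_succ]
    nlinarith)
  refine ⟨f, hf0, hfD.le, fun f' hf' => ?_⟩
  have hbrute : D * N ≤ (bruteCoprime N (bitsOfPoly f)).cost := by
    refine le_trans ?_ (le_bruteCoprime_cost hN2 (by rwa [polyOfBits_bitsOfPoly]))
    rw [length_bitsOfPoly, hfD]
    exact Nat.mul_le_mul (Nat.le_succ D) hNpow
  have hfast := fastCoprime_bitsOfPoly_cost_le (N := N) (by omega) hf'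
  rw [← hL] at hfast
  have hbrute' : (D : ℝ) * N ≤ (bruteCoprime N (bitsOfPoly f)).cost := by exact_mod_cast hbrute
  have hfast' : ((fastCoprime N (bitsOfPoly f')).cost : ℝ) ≤ 6 * L * D + 3500 * (N : ℝ) ^ 2 := by
    exact_mod_cast hfast
  have hND' : (N : ℝ) * L ≤ D := by exact_mod_cast hND
  have e₁ : 12 * (L : ℝ) * D ≤ ε * N * D := by gcongr
  have e₂ : 7000 * (N : ℝ) ^ 2 ≤ ε * (D * N) := by
    calc 7000 * (N : ℝ) ^ 2 ≤ ε * L * (N : ℝ) ^ 2 := by gcongr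
      _ = ε * (N * L * N) := by ring
      _ ≤ ε * (D * N) := by gcongr
  have e₃ := mul_le_mul_of_nonneg_left hbrute' hε.le
  linarith

theorem sq_add_le_mul_logb {ε : ℝ} (hε : 0 < ε) :
    ∃ N₀ : ℕ, ∀ N h Λ : ℕ, N₀ ≤ N → 1 ≤ h → 1 ≤ Λ →
      ∀ n : ℝ, n = N * h * Λ * Real.logb 2 N →
        (N : ℝ) ^ 2 + h * N * (Real.logb 2 N) ^ 2 * Λ ≤
          ε * ((N : ℝ) ^ 2 * h * Λ * Real.logb 2 n) ∧
        (N : ℝ) ^ 2 + h * N * (Real.logb 2 N) ^ 2 * Λ ≤ ε * (n ^ 2 * Real.logb 2 n) := by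
  obtain ⟨N₀, hN₀⟩ := exists_forall_le_logb_and_logb_le (max 1 (2 / ε)) (δ := ε / 2)
    (by positivity)
  refine ⟨N₀, fun N h Λ hN hh hΛ n hn => ?_⟩
  obtain ⟨h₁, h₂⟩ := hN₀ N hN
  have h₃ : 1 ≤ Real.logb 2 N := (le_max_left _ _).trans h₁
  have h₄ : 2 ≤ ε * Real.logb 2 N := by
    have := (le_max_right _ _).trans h₁
    rw [div_le_iff₀ hε] at this
    linarith
  have hN0 : 0 < (N : ℝ) := by
    rcases Nat.eq_zero_or_pos N with rfl | hpos
    · norm_num at h₃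
    · exact_mod_cast hpos
  have hP : (1 : ℝ) ≤ h * Λ := by exact_mod_cast Nat.mul_pos hh hΛ
  set l := Real.logb 2 N with hl
  have hPl : 1 ≤ h * Λ * l := one_le_mul_of_one_le_of_one_le hP h₃
  -- Only `log n ≥ log N` is needed, from `n ≥ N`.
  have hln : l ≤ Real.logb 2 n := by
    refine Real.logb_le_logb_of_le one_lt_two hN0 ?_
    rw [hn]
    nlinarith
  have key : (N : ℝ) ^ 2 + h * N * l ^ 2 * Λ ≤ ε * ((N : ℝ) ^ 2 * h * Λ * Real.logb 2 n) := by
    have e₁ : 2 * (N : ℝ) ^ 2 ≤ ε * ((N : ℝ) ^ 2 * h * Λ * l) := by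
      calc 2 * (N : ℝ) ^ 2 ≤ (ε * l) * (N : ℝ) ^ 2 := by gcongr
        _ = ε * l * (N : ℝ) ^ 2 * 1 := by ring
        _ ≤ ε * l * (N : ℝ) ^ 2 * (h * Λ) := by gcongr
        _ = _ := by ring
    have e₂ : h * N * l ^ 2 * Λ ≤ ε / 2 * ((N : ℝ) ^ 2 * h * Λ * l) := by
      calc h * N * l ^ 2 * Λ = h * N * l * Λ * l := by ring
        _ ≤ h * N * l * Λ * (ε / 2 * N) := by gcongr
        _ = _ := by ring
    have e₃ : ε * ((N : ℝ) ^ 2 * h * Λ * l) ≤ ε * ((N : ℝ) ^ 2 * h * Λ * Real.logb 2 n) := by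
      gcongr
    linarith
  refine ⟨key, key.trans ?_⟩
  have e : (N : ℝ) ^ 2 * h * Λ ≤ n ^ 2 := by
    calc (N : ℝ) ^ 2 * h * Λ = (N : ℝ) ^ 2 * (h * Λ * 1) := by ring
      _ ≤ (N : ℝ) ^ 2 * ((h * Λ * l) * (h * Λ * l)) :=
        mul_le_mul_of_nonneg_left (mul_le_mul (le_mul_of_one_le_right (by linarith) h₃) hPl
          zero_le_one (by linarith)) (sq_nonneg _)
      _ = n ^ 2 := by rw [hn]; ring
  have : 0 ≤ Real.logb 2 n := by linarith
  gcongr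

theorem mainTheorem1 :
    -- correctness of the fast algorithm
    (∀ (N : ℕ) (f : (ZMod 2)[X]), IsLeastCoprime N f (fastCoprime N (bitsOfPoly f)).val) ∧
    -- running time `O(N²) + O(h N (log N)² Λ)`
    (∃ c : ℝ,
      (∀ (N h Λ : ℕ) (f : (ZMod 2)[X]), 1 ≤ N → f.natDegree ≤ N * Nat.clog 2 N * h * Λ →
        ((fastCoprime N (bitsOfPoly f)).cost : ℝ) ≤
          c * (N : ℝ) ^ 2 + c * (h * N * (Real.logb 2 N) ^ 2 * Λ)) ∧
      -- the polynomial `f` of a network code, in terms of the parameters of the network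
      (∀ (V E : Type) [Fintype V] [Fintype E] [DecidableEq E] (G : MulticastNetwork V E) (d : ℕ)
        (C : G.Code (ZMod 2)[X] d), d ≤ G.minCut → C.DegreeLE (Nat.clog 2 G.sinks.card) →
        ((fastCoprime G.sinks.card (bitsOfPoly C.detProd)).cost : ℝ) ≤
          c * (G.sinks.card : ℝ) ^ 2 +
            c * (G.minCut * G.sinks.card * (Real.logb 2 G.sinks.card) ^ 2 * G.longestPath))) ∧
    -- the worst case is of lower order than the worst case of the brute-force search
    (∀ ε : ℝ, 0 < ε → ∃ N₀ : ℕ, ∀ N h Λ : ℕ, N₀ ≤ N → 1 ≤ h → 1 ≤ Λ →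
      ∃ f : (ZMod 2)[X], f ≠ 0 ∧ f.natDegree ≤ N * Nat.clog 2 N * h * Λ ∧
        ∀ f' : (ZMod 2)[X], f'.natDegree ≤ N * Nat.clog 2 N * h * Λ →
          ((fastCoprime N (bitsOfPoly f')).cost : ℝ) ≤
            ε * ((bruteCoprime N (bitsOfPoly f)).cost : ℝ)) ∧
    -- the bound is of lower order than both `N² h Λ log n` and `n² log n`, `n = N h Λ log N`
    (∀ ε : ℝ, 0 < ε → ∃ N₀ : ℕ, ∀ N h Λ : ℕ, N₀ ≤ N → 1 ≤ h → 1 ≤ Λ →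
      ∀ n : ℝ, n = N * h * Λ * Real.logb 2 N →
        (N : ℝ) ^ 2 + h * N * (Real.logb 2 N) ^ 2 * Λ ≤
          ε * ((N : ℝ) ^ 2 * h * Λ * Real.logb 2 n) ∧
        (N : ℝ) ^ 2 + h * N * (Real.logb 2 N) ^ 2 * Λ ≤ ε * (n ^ 2 * Real.logb 2 n)) := by 
  -- The constant need only exceed `3500` and `48`, the latter being `24` doubled by the passage to
  -- `2 * Λ`.
  refine ⟨isLeastCoprime_fastCoprime, ⟨7000, ?_, ?_⟩,
    fun ε hε => fastCoprime_cost_le_mul_bruteCoprime_cost hε, fun ε hε => sq_add_le_mul_logb hε⟩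
  · intro N h Λ f hN hf
    have h₁ := fastCoprime_cost_le_of_natDegree_le hN hf
    have h₂ : (0 : ℝ) ≤ (N : ℝ) ^ 2 := by positivity
    have h₃ : (0 : ℝ) ≤ h * N * (Real.logb 2 N) ^ 2 * Λ := by positivity
    linarith
  · intro V E _ _ _ G d C hd hC
    have h₁ := fastCoprime_cost_le_of_natDegree_le (Finset.card_pos.2 G.sinks_nonempty)
      (hC.natDegree_detProd_le hd)
    have h₂ : (0 : ℝ) ≤ (G.sinks.card : ℝ) ^ 2 := by positivity
    have h₃ : (0 : ℝ) ≤
        G.minCut * G.sinks.card * (Real.logb 2 G.sinks.card) ^ 2 * G.longestPath := by positivity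
    push_cast at h₁
    linarith
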